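/- **Setting.** Let $\mathcal X$ and $\mathcal I\neq\emptyset$ be finite sets, and let $\mu$ be a spin system, i.e. a probability measure on $\mathcal X^{\mathcal I}$, with support $\Omega=\{x:\mu(x)>0\}$. For $S\subseteq\mathcal I$ write $x_S=(x_j)_{j\in S}$, let $\mu_S$ be the marginal of $\mu$ on $\mathcal X^S$, and let $\mu(y_i\mid x_S)$ denote the conditional probability that the spin at $i$ is $y_i$ given that the spins in $S$ are $x_S$; put $\overline x_i=x_{\mathcal I\setminus\{i\}}$. Let $d_{\mathrm{TV}}(p,q)=\frac12\sum_x|p(x)-q(x)|$. * $\tilde\beta(\mu)=\inf_{S\subsetneq\mathcal I}\ \inf_{i\notin S}\ \inf\{\mu(z_i\mid z_S): z\in\Omega\}$. * An *interdependence matrix* of $\mu$ is a real matrix $J=(J_{ij})_{i,j\in\mathcal I}$ with $J_{ii}=0$ such that $d_{\mathrm{TV}}(\mu(\cdot\mid\overline x_i),\mu(\cdot\mid\overline y_i))\le J_{ij}$ for all $i,j\in\mathcal I$ and all $x,y\in\mathcal X^{\mathcal I}$ with $\overline x_j=\overline y_j$. Here $\mu(\cdot\mid\overline x_i)$ is a version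 of the conditional law defined for all $\overline x_i\in\mathcal X^{\mathcal I\setminus\{i\}}$: a probability measure on $\mathcal X$, equal to the elementary conditional probability if $\mu_{\mathcal I\setminus\{i\}}(\overline x_i)>0$; if some $\overline x_i$ have probability zero, the inequalities are required for some choice of the version. $\|J\|_{2\to2}$ is the Euclidean operator norm. * The *Glauber dynamics* is the Markov chain on $\Omega$ with transition matrix $P(x,y)=|\mathcal I|^{-1}\sum_{i\in\mathcal I}\mu(y_i\mid\overline x_i)\prod_{j\ne i}\mathbf 1_{x_j=y_j}$. The *Glauber semigroup* is $P_t=\exp(t(P-I))$, $t\ge0$. * $\mathrm{Ent}_\mu(f)=\mathbb E_\mu f\log f-\mathbb E_\mu f\,\log\mathbb E_\mu f$ for $f\ge 0$, and $\mathcal E(f,g)=\mathbb E_\mu[f\,(I-P)g]$. $\mathrm{mLSI}(\rho_0)$ means $\mathrm{Ent}_\mu(f)\le\frac{\rho_0}{2}\,\mathcal E(f,\log f)$ for all $f:\Omega\to[0,\infty)$ (with $\log0=-\infty$ and $0\cdot(\pm\infty)=0$, so that $\mathcal E(f,\log f)\in[0,\infty]$). * $t_{\mathrm{mix}}=\inf\{t\ge0:\max_{y\in\Omega}d_{\mathrm{TV}}(P_t(y,\cdot),\mu)\le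 e^{-1}\}$. **Theorem.** Let $\alpha_1,\alpha_2>0$ and let $\mu$ be a spin system with $\tilde\beta(\mu)\ge\alpha_1$ that has an interdependence matrix $J$ with $\|J\|_{2\to2}\le1-\alpha_2$. Then the Glauber dynamics of $\mu$ satisfies $\mathrm{mLSI}(2|\mathcal I|\alpha_1^{-1}\alpha_2^{-2})$. Moreover, for every $\mu$-density $f$ (i.e. $f:\Omega\to[0,\infty)$ with $\mathbb E_\mu f=1$) and all $t\ge0$, $P_tf$ is a $\mu$-density and $$\mathrm{Ent}_\mu(P_tf)\le\mathrm{Ent}_\mu(f)\,\exp\Big(-\frac{\alpha_1\alpha_2^2}{2|\mathcal I|}\,t\Big).$$ Furthermore, if $(\mu_n)_{n}$ is a sequence of spin systems on $\mathcal X^{\mathcal I_n}$ with $\mathcal I_n\ne\emptyset$ finite and $|\mathcal I_n|\to\infty$, each satisfying the two assumptions with the same constants $\alpha_1,\alpha_2>0$ not depending on $n$, then the Glauber dynamics is rapidly mixing: $t_{\mathrm{mix}}(n)=O(|\mathcal I_n|\log|\mathcal I_n|)$ as $n\to\infty$. -/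

import Mathlib

open Filter

noncomputable section

namespace SpinSystem

/-! ### Finite Markov chains, with state space `Ω`, transition matrix `P`, reversible law `π` -/

section Chain

variable {Ω : Type*} [Fintype Ω]

/-- Total variation distance of two probability vectors on a finite set. -/
def dTV (p q : Ω → ℝ) : ℝ := (1 / 2) * ∑ x, |p x - q x|

/-- The entropy `E_π (f log f) - E_π f log (E_π f)` of a function `f ≥ 0`
(here `Real.log 0 = 0`, so `0 log 0 = 0`). -/
def Ent (π : Ω → ℝ) (f : Ω → ℝ) : ℝ :=
  ∑ x, π x * (f x * Real.log (f x)) - (∑ x, π x * f x) * Real.log (∑ x, π x * f x)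

/-- The logarithm of a real number `r ≥ 0` as an extended real number, with `log 0 = -∞`. -/
def extLog (r : ℝ) : EReal := ENNReal.log (ENNReal.ofReal r)

/-- The Dirichlet form `E_π (f · (-L g))`, where `-L = I - P`, i.e. `-L g = g - P g`.
The function `g` may take the value `-∞`; products with `0` are `0`. -/
def dirichletForm (P : Matrix Ω Ω ℝ) (π : Ω → ℝ) (f : Ω → ℝ) (g : Ω → EReal) : EReal :=
  ∑ x, ((π x * f x : ℝ) : EReal) * (g x - ∑ y, (P x y : EReal) * g y)

/-- The modified logarithmic Sobolev inequality `mLSI(ρ)`: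
`Ent_π(f) ≤ (ρ / 2) 𝓔(f, log f)` for all `f : Ω → [0, ∞)`.  For `f` with zeros, `log f` is `-∞`
there and the right-hand side is read in the extended reals (it may be `+∞`). -/
def MLSI (P : Matrix Ω Ω ℝ) (π : Ω → ℝ) (ρ : ℝ) : Prop :=
  ∀ f : Ω → ℝ, (∀ x, 0 ≤ f x) →
    ((Ent π f : ℝ) : EReal) ≤
      ((ρ / 2 : ℝ) : EReal) * dirichletForm P π f (fun x => extLog (f x))

open scoped Classical in
/-- The continuous-time semigroup `P_t = exp (t L)` with generator `L = P - I`. -/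
def semigroup (P : Matrix Ω Ω ℝ) (t : ℝ) : Matrix Ω Ω ℝ := NormedSpace.exp (t • (P - 1))

/-- The mixing time `inf {t ≥ 0 : max_y d_TV(P_t(y, ·), π) ≤ e⁻¹}` of the continuous-time chain,
as an extended nonnegative number (`∞` if there is no such `t`). -/
def mixingTime (P : Matrix Ω Ω ℝ) (π : Ω → ℝ) : ENNReal :=
  ⨅ (t : ℝ) (_ : 0 ≤ t ∧ ∀ y, dTV (semigroup P t y) π ≤ Real.exp (-1)), ENNReal.ofReal t

/-- `f` is a probability density with respect to `π`. -/
def IsDensity (π : Ω → ℝ) (f : Ω → ℝ) : Prop := (∀ x, 0 ≤ f x) ∧ ∑ x, π x * f x = 1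

end Chain

/-! ### Spin systems: probability measures on `I → X` with `I` (sites), `X` (spins) finite -/

section Spin

variable {I X : Type*} [Fintype I] [Fintype X]

/-- The configurations of positive probability. -/
def Supp (μ : PMF (I → X)) : Type _ := {x : I → X // μ x ≠ 0}

open scoped Classical in
instance (μ : PMF (I → X)) : Fintype (Supp μ) :=
  inferInstanceAs (Fintype {x : I → X // μ x ≠ 0})

/-- `μ` as a probability vector on its support. -/
def mass (μ : PMF (I → X)) (x : Supp μ) : ℝ := (μ x.1).toReal

open scoped Classical in
/-- The marginal probability `μ_S(x_S) = μ {z | z = x on S}`. -/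
def marginal (μ : PMF (I → X)) (S : Set I) (x : I → X) : ℝ :=
  ∑ z : I → X, if ∀ j ∈ S, z j = x j then (μ z).toReal else 0

open scoped Classical in
/-- The conditional probability `μ(z_i = a | z_S = x_S)`, meaningful if `μ_S(x_S) > 0`. -/
def condProb (μ : PMF (I → X)) (S : Set I) (i : I) (x : I → X) (a : X) : ℝ :=
  (∑ z : I → X, if (∀ j ∈ S, z j = x j) ∧ z i = a then (μ z).toReal else 0) / marginal μ S x

open scoped Classical in
/-- The transition matrix of the Glauber dynamics on the support of `μ`: a site `i` is chosen
uniformly at random and the spin at `i` is resampled from `μ(· | x_j, j ≠ i)`. -/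
def glauber (μ : PMF (I → X)) : Matrix (Supp μ) (Supp μ) ℝ := fun x y =>
  (Fintype.card I : ℝ)⁻¹ *
    ∑ i, condProb μ {i}ᶜ i x.1 (y.1 i) * (if ∀ j, j ≠ i → x.1 j = y.1 j then 1 else 0)

/-- The infimum of `μ(y_i | x_S)` over all `x_S` and `y` on the complement of `S` with
`μ(y, x_S) > 0`; a pair `(y, x_S)` of this kind is the same thing as a point `z` of the support. -/
def betaTildeAt (μ : PMF (I → X)) (S : Set I) (i : I) : ℝ :=
  ⨅ z : Supp μ, condProb μ S i z.1 (z.1 i)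

/-- The infimum of `betaTildeAt μ S i` over all proper subsets `S` of `I` and all `i ∉ S`. -/
def betaTilde (μ : PMF (I → X)) : ℝ :=
  ⨅ S : {S : Set I // S ≠ Set.univ}, ⨅ i : {i : I // i ∉ S.1}, betaTildeAt μ S.1 i.1

/-- `Q i x` is a version of the conditional law `μ(· | x_j, j ≠ i)` of the spin at `i` given the
other spins, defined for all configurations: a probability vector on `X` that depends on
`(x_j)_{j ≠ i}` only and is the elementary conditional probability wherever the conditioning
event has positive probability. -/
def IsCondVersion (μ : PMF (I → X)) (Q : I → (I → X) → X → ℝ) : Prop :=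
  (∀ i x, Q i x ∈ stdSimplex ℝ X) ∧
  (∀ i x y, (∀ j, j ≠ i → x j = y j) → Q i x = Q i y) ∧
  (∀ i x, 0 < marginal μ {i}ᶜ x → ∀ a, Q i x a = condProb μ {i}ᶜ i x a)

/-- `J` is an interdependence matrix of `μ`: `J i i = 0`, and `J i j` bounds the total variation
distance of `μ(· | x_k, k ≠ i)` and `μ(· | y_k, k ≠ i)` for all configurations `x`, `y` that agree
off `j`.  If some conditioning events are null sets, this is required of some version of the
conditional laws. -/
def IsInterdependenceMatrix (μ : PMF (I → X)) (J : Matrix I I ℝ) : Prop :=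
  (∀ i, J i i = 0) ∧
  ∃ Q : I → (I → X) → X → ℝ, IsCondVersion μ Q ∧
    ∀ i j x y, (∀ k, k ≠ j → x k = y k) → dTV (Q i x) (Q i y) ≤ J i j

open scoped Classical in
/-- The operator norm of a matrix with respect to the Euclidean norms. -/
def norm22 (J : Matrix I I ℝ) : ℝ := ‖Matrix.toEuclideanCLM (𝕜 := ℝ) J‖

/-- `(α₁, α₂)`-weak dependence. -/
def WeaklyDependent (μ : PMF (I → X)) (α₁ α₂ : ℝ) : Prop :=
  α₁ ≤ betaTilde μ ∧ ∃ J : Matrix I I ℝ, IsInterdependenceMatrix μ J ∧ norm22 J ≤ 1 - α₂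

end Spin

end SpinSystem

end

/-!
Why the theorem is true.  Write `φ u = u log u`, let `w` be the law of the spin system, and let
`E_S f` be the conditional expectation of `f` given the spins in `S`.  The heart of the matter is
the bound `Ent f ≤ (α₁ α₂²)⁻¹ ∑ i, E [f (log f - R_i log f)]`, in which `R_i` resamples the spin
at `i`; the sum over `i` is `|I|` times the Dirichlet form of the Glauber dynamics at `(f, log f)`.

*Reduction to one spin* (`partialEnt_univ_sub_le`).  By the chain rule, the entropy not yet seen on
`S` is, for each `i ∉ S`, the entropy of the spin at `i` given those in `S`, plus the entropy not
yet seen on `S ∪ {i}`.  Averaging over `i` and inducting over the number of sites off `S`, it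
suffices to bound, for the measure pinned on `S`, the sum over `i ∉ S` of the entropies of single
spins (`sum_pin_entropy_le`).  Pinning preserves all hypotheses, with the same kernels and the same
matrix `J`.

*One spin.*  Let `q` be a pinned measure and `p` the measure with density proportional to `f`.
Since the atoms of the laws of single spins under `q` are at least `α₁`, relative entropy is at
most `2 / α₁` times squared total variation (`sum_siteMass_entropy_le`).  Dobrushin's comparison
method (`sum_siteTV_sq_le`) bounds the vector of these total variation distances in Euclidean norm
by `α₂⁻¹ ‖t‖`, where `t i` is the `p`-average of the distance between the two conditional
laws, under `p` and `q`, of the spin at `i` given all others.  If `f` has `q`-mean one, then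
`(t i)²` is at most half the entropy production of `f` at `i`, by
`log u ≥ 1 - 1 / u` and Cauchy-Schwarz (`sq_sum_abs_sub_resample_le`).

*Zeros.*  If `P x y > 0`, `f x > 0` and `f y = 0`, the Dirichlet form is `+∞`.  Otherwise the zeros
of `f` do not communicate with the rest of the support, and the Dirichlet form is computed with the
real logarithm (`mlsi_of_realDirichlet`).

*Decay and mixing.*  For positive densities the derivative of `Ent (P_t f)` is minus the Dirichlet
form (`hasDerivAt_ent`), which gives exponential decay; general densities follow by continuity of
the entropy.  Started from a point mass, whose entropy is at most `|I| |log α₁|` by the chain rule,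
the decay and a Pinsker type inequality bound the mixing time.
-/

noncomputable section

namespace SpinSystem

set_option linter.unusedSectionVars false

/-! ### Resampling the spin at one site -/

section Resampling

open scoped Classical

variable {I X : Type*} [Fintype I] [Fintype X]

/-- `K` resamples the spin at `i` according to the weight `w`: `K x` is a probability vector on the
spins which does not depend on the spin of `x` at `i`, and it is proportional to `w` on the
configurations that agree with `x` off `i`.  The last condition is empty if all of these have
weight zero, so that `K` may be any version of the conditional law. -/
structure IsSiteKernel (w : (I → X) → ℝ) (i : I) (K : (I → X) → X → ℝ) : Prop where
  nonneg : ∀ x a, 0 ≤ K x a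
  sum_eq_one : ∀ x, ∑ a, K x a = 1
  update_eq : ∀ x a, K (Function.update x i a) = K x
  balance : ∀ x a, w (Function.update x i a) = K x a * ∑ b, w (Function.update x i b)

/-- The expectation of `g` after the spin at `i` has been resampled from `K x`. -/
def resample (i : I) (K : (I → X) → X → ℝ) (g : (I → X) → ℝ) (x : I → X) : ℝ :=
  ∑ a, K x a * g (Function.update x i a)

/-- The oscillation of `g` in the spin at `j` is at most `δ j`, for every site `j`. -/
def OscLE (g : (I → X) → ℝ) (δ : I → ℝ) : Prop :=
  ∀ j x a, |g (Function.update x j a) - g x| ≤ δ j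

lemma OscLE.nonneg {g : (I → X) → ℝ} {δ : I → ℝ} (h : OscLE g δ) (x : I → X) (j : I) :
    0 ≤ δ j :=
  (abs_nonneg _).trans (h j x (x j))

lemma sum_sum_update_comm (i : I) (G : (I → X) → (I → X) → ℝ) :
    ∑ x, ∑ a, G x (Function.update x i a) = ∑ x, ∑ a, G (Function.update x i a) x := by
  rw [← Fintype.sum_prod_type', ← Fintype.sum_prod_type']
  let e : (I → X) × X → (I → X) × X := fun p => (Function.update p.1 i p.2, p.1 i)
  have he : Function.Involutive e := by
    rintro ⟨x, a⟩
    simp [e]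
  refine Fintype.sum_equiv he.toPerm _ _ ?_
  rintro ⟨x, a⟩
  simp [Function.Involutive.toPerm, e]

section SiteKernel

variable {w : (I → X) → ℝ} {i : I} {K : (I → X) → X → ℝ}

lemma resample_update (hK : IsSiteKernel w i K) (g : (I → X) → ℝ) (x : I → X) (a : X) :
    resample i K g (Function.update x i a) = resample i K g x := by
  simp [resample, hK.update_eq]

lemma resample_eq_self (hK : IsSiteKernel w i K) {g : (I → X) → ℝ}
    (hg : ∀ x a, g (Function.update x i a) = g x) (x : I → X) : resample i K g x = g x := by
  simp [resample, hg, ← Finset.sum_mul, hK.sum_eq_one]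

lemma IsSiteKernel.weight_eq (hK : IsSiteKernel w i K) (x : I → X) :
    w x = K x (x i) * ∑ b, w (Function.update x i b) := by
  simpa using hK.balance x (x i)

/-- Resampling at a site is self-adjoint with respect to the weight. -/
lemma sum_mul_resample_comm (hK : IsSiteKernel w i K) (h g : (I → X) → ℝ) :
    ∑ x, w x * (h x * resample i K g x) = ∑ x, w x * (resample i K h x * g x) := by
  let G : (I → X) → (I → X) → ℝ := fun x y =>
    (∑ b, w (Function.update x i b)) * (K x (x i) * K x (y i)) * (h x * g y)
  have h1 : ∀ x, w x * (h x * resample i K g x) = ∑ a, G x (Function.update x i a) := by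
    intro x
    simp only [G, Function.update_self]
    rw [hK.weight_eq x, resample]
    generalize ∑ b, w (Function.update x i b) = m
    rw [Finset.mul_sum, Finset.mul_sum]
    refine Finset.sum_congr rfl fun a _ => ?_
    ring
  have h2 : ∀ x, w x * (resample i K h x * g x) = ∑ a, G (Function.update x i a) x := by
    intro x
    simp only [G, Function.update_self, hK.update_eq, Function.update_idem]
    rw [hK.weight_eq x, resample]
    generalize ∑ b, w (Function.update x i b) = m
    rw [Finset.sum_mul, Finset.mul_sum]
    refine Finset.sum_congr rfl fun a _ => ?_
    ring
  simp only [h1, h2]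
  exact sum_sum_update_comm i G

lemma sum_mul_resample (hK : IsSiteKernel w i K) (g : (I → X) → ℝ) :
    ∑ x, w x * resample i K g x = ∑ x, w x * g x := by
  have h := sum_mul_resample_comm hK (fun _ => 1) g
  have h1 : ∀ x, resample i K (fun _ => (1 : ℝ)) x = 1 :=
    fun x => resample_eq_self hK (fun _ _ => rfl) x
  simpa [h1] using h

/-- The difference `f - resample f` is orthogonal to functions that do not depend on the resampled
spin. -/
lemma sum_sub_resample_mul_eq_zero (hK : IsSiteKernel w i K) (f : (I → X) → ℝ)
    {c : (I → X) → ℝ} (hc : ∀ x a, c (Function.update x i a) = c x) :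
    ∑ x, w x * ((f x - resample i K f x) * c x) = 0 := by
  have h := sum_mul_resample_comm hK f c
  simp only [resample_eq_self hK hc] at h
  simp only [sub_mul, mul_sub, Finset.sum_sub_distrib, h, sub_self]

/-- The midpoint between the largest and the smallest value. -/
def midrange (h : X → ℝ) : ℝ := ((⨆ a, h a) + ⨅ a, h a) / 2

lemma abs_sub_midrange_le {h : X → ℝ} {δ : ℝ} (hδ : ∀ a b, |h a - h b| ≤ δ) (a : X) :
    |h a - midrange h| ≤ δ / 2 := by
  have : Nonempty X := ⟨a⟩
  have hs : h a ≤ ⨆ a, h a := le_ciSup (Set.finite_range h).bddAbove a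
  have hi : ⨅ a, h a ≤ h a := ciInf_le (Set.finite_range h).bddBelow a
  have hd : (⨆ a, h a) ≤ (⨅ a, h a) + δ := by
    refine ciSup_le fun b => ?_
    rw [← sub_le_iff_le_add]
    refine le_ciInf fun c => ?_
    linarith [le_abs_self (h b - h c), hδ b c]
  rw [abs_le, midrange]
  constructor <;> linarith

/-- A difference of two probability vectors, tested against a function of oscillation `δ`. -/
lemma abs_sum_mul_le {u h : X → ℝ} {δ : ℝ} (hu : ∑ a, u a = 0) (hδ : ∀ a b, |h a - h b| ≤ δ) :
    |∑ a, u a * h a| ≤ (1 / 2 * ∑ a, |u a|) * δ := by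
  have h0 : ∑ a, u a * h a = ∑ a, u a * (h a - midrange h) := by
    simp [mul_sub, ← Finset.sum_mul, hu]
  rw [h0]
  calc _ ≤ ∑ a, |u a * (h a - midrange h)| := Finset.abs_sum_le_sum_abs _ _
    _ ≤ ∑ a, |u a| * (δ / 2) := by
      refine Finset.sum_le_sum fun a _ => ?_
      rw [abs_mul]
      exact mul_le_mul_of_nonneg_left (abs_sub_midrange_le hδ a) (abs_nonneg _)
    _ = _ := by rw [← Finset.sum_mul]; ring

lemma OscLE.abs_update_sub_update_le {g : (I → X) → ℝ} {δ : I → ℝ} (h : OscLE g δ) (j : I)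
    (x : I → X) (a b : X) :
    |g (Function.update x j a) - g (Function.update x j b)| ≤ δ j := by
  simpa using h j (Function.update x j b) a

lemma abs_sum_sub_resample_mul_le (hw : ∀ x, 0 ≤ w x) (hK : IsSiteKernel w i K)
    (f : (I → X) → ℝ) {g : (I → X) → ℝ} {δ : I → ℝ} (hg : OscLE g δ) :
    |∑ x, w x * ((f x - resample i K f x) * g x)| ≤
      (1 / 2 * ∑ x, w x * |f x - resample i K f x|) * δ i := by
  let c : (I → X) → ℝ := fun x => midrange fun a => g (Function.update x i a)
  have hc : ∀ x a, c (Function.update x i a) = c x := by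
    intro x a
    simp [c]
  have h0 : ∑ x, w x * ((f x - resample i K f x) * g x) =
      ∑ x, w x * ((f x - resample i K f x) * (g x - c x)) := by
    have := sum_sub_resample_mul_eq_zero hK f hc
    simp only [mul_sub] at this ⊢
    simp only [Finset.sum_sub_distrib, this, sub_zero]
  rw [h0]
  calc _ ≤ ∑ x, |w x * ((f x - resample i K f x) * (g x - c x))| :=
        Finset.abs_sum_le_sum_abs _ _
    _ ≤ ∑ x, w x * |f x - resample i K f x| * (δ i / 2) := by
      refine Finset.sum_le_sum fun x _ => ?_
      rw [abs_mul, abs_mul, abs_of_nonneg (hw x), ← mul_assoc]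
      refine mul_le_mul_of_nonneg_left ?_ (mul_nonneg (hw x) (abs_nonneg _))
      simpa using abs_sub_midrange_le (hg.abs_update_sub_update_le i x) (x i)
    _ = _ := by rw [← Finset.sum_mul]; ring

/-- Resampling at `i` removes the oscillation at `i` and passes it on to the other sites `j`, in
proportion to the influence `r j` of `j` on the resampling kernel. -/
lemma OscLE.resample (hK : IsSiteKernel w i K) {r : I → ℝ}
    (hr : ∀ j x a, dTV (K (Function.update x j a)) (K x) ≤ r j)
    {g : (I → X) → ℝ} {δ : I → ℝ} (hg : OscLE g δ) :
    OscLE (resample i K g) fun j => if j = i then 0 else δ j + r j * δ i := by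
  intro j x a
  by_cases hj : j = i
  · subst hj
    simp [resample_update hK]
  simp only [if_neg hj]
  have hsplit : SpinSystem.resample i K g (Function.update x j a) - SpinSystem.resample i K g x =
      ∑ b, K x b * (g (Function.update (Function.update x j a) i b) - g (Function.update x i b)) +
      ∑ b, (K (Function.update x j a) b - K x b) *
        g (Function.update (Function.update x j a) i b) := by
    rw [SpinSystem.resample, SpinSystem.resample, ← Finset.sum_add_distrib,
      ← Finset.sum_sub_distrib]
    refine Finset.sum_congr rfl fun b _ => ?_
    ring
  rw [hsplit]
  refine (abs_add_le _ _).trans (add_le_add ?_ ?_)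
  · calc _ ≤ ∑ b, |K x b * (g (Function.update (Function.update x j a) i b) -
            g (Function.update x i b))| := Finset.abs_sum_le_sum_abs _ _
      _ ≤ ∑ b, K x b * δ j := by
        refine Finset.sum_le_sum fun b _ => ?_
        rw [abs_mul, abs_of_nonneg (hK.nonneg x b), Function.update_comm hj]
        exact mul_le_mul_of_nonneg_left (hg j _ _) (hK.nonneg x b)
      _ = δ j := by rw [← Finset.sum_mul, hK.sum_eq_one, one_mul]
  · refine (abs_sum_mul_le ?_ (hg.abs_update_sub_update_le i _)).trans ?_
    · rw [Finset.sum_sub_distrib, hK.sum_eq_one, hK.sum_eq_one, sub_self]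
    · exact mul_le_mul_of_nonneg_right (hr j x a) (hg.nonneg x i)

lemma resample_nonneg (hK : IsSiteKernel w i K) {f : (I → X) → ℝ} (hf : ∀ x, 0 ≤ f x)
    (x : I → X) : 0 ≤ resample i K f x :=
  Finset.sum_nonneg fun a _ => mul_nonneg (hK.nonneg x a) (hf _)

lemma IsSiteKernel.ne_zero (hK : IsSiteKernel w i K) {x : I → X} (hx : w x ≠ 0) :
    K x (x i) ≠ 0 := by
  intro h
  exact hx (by rw [hK.weight_eq x, h, zero_mul])

lemma IsSiteKernel.eq_zero_of_weight (hK : IsSiteKernel w i K) {x : I → X} (hx : w x ≠ 0) {a : X}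
    (ha : w (Function.update x i a) = 0) : K x a = 0 := by
  rw [hK.balance] at ha
  refine (mul_eq_zero.1 ha).resolve_right fun h => hx ?_
  rw [hK.weight_eq x, h, mul_zero]

/-- The zeros of `f` on the support of `w` are stable under changing the spin at `i`. -/
def ZerosStable (w : (I → X) → ℝ) (f : (I → X) → ℝ) (i : I) : Prop :=
  ∀ x a, w x ≠ 0 → w (Function.update x i a) ≠ 0 → f x = 0 → f (Function.update x i a) = 0

lemma resample_eq_zero_iff (hK : IsSiteKernel w i K) {f : (I → X) → ℝ} (hf : ∀ x, 0 ≤ f x)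
    (hz : ZerosStable w f i) {x : I → X} (hx : w x ≠ 0) : resample i K f x = 0 ↔ f x = 0 := by
  constructor
  · intro h
    rw [resample, Finset.sum_eq_zero_iff_of_nonneg
      fun a _ => mul_nonneg (hK.nonneg x a) (hf _)] at h
    have := h (x i) (Finset.mem_univ _)
    simpa [hK.ne_zero hx] using this
  · intro h
    refine Finset.sum_eq_zero fun a _ => ?_
    by_cases ha : w (Function.update x i a) = 0
    · rw [hK.eq_zero_of_weight hx ha, zero_mul]
    · rw [hz x a hx ha h, mul_zero]

/-- The entropy production `E [f (log f - resample (log f))]` of resampling the spin at `i`. -/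
def entProd (w : (I → X) → ℝ) (i : I) (K : (I → X) → X → ℝ) (f : (I → X) → ℝ) : ℝ :=
  ∑ x, w x * (f x * (Real.log (f x) - resample i K (fun y => Real.log (f y)) x))

lemma entProd_eq (hK : IsSiteKernel w i K) (f : (I → X) → ℝ) :
    entProd w i K f = ∑ x, w x * ((f x - resample i K f x) *
      (Real.log (f x) - Real.log (resample i K f x))) := by
  have h1 := sum_mul_resample_comm hK f (fun y => Real.log (f y))
  have h2 := sum_sub_resample_mul_eq_zero hK f (c := fun x => Real.log (resample i K f x))
    (fun x a => by rw [resample_update hK])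
  have h3 : ∀ x, w x * ((f x - resample i K f x) *
      (Real.log (f x) - Real.log (resample i K f x))) =
      w x * (f x * Real.log (f x)) - w x * (resample i K f x * Real.log (f x)) -
      w x * ((f x - resample i K f x) * Real.log (resample i K f x)) := fun x => by ring
  rw [Finset.sum_congr rfl fun x _ => h3 x, Finset.sum_sub_distrib, Finset.sum_sub_distrib, h2,
    ← h1, sub_zero, ← Finset.sum_sub_distrib, entProd]
  simp only [mul_sub]

lemma sq_sub_le_mul_log {u v : ℝ} (hu : 0 < u) (hv : 0 < v) :
    (u - v) ^ 2 ≤ (u + v) * ((u - v) * (Real.log u - Real.log v)) := by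
  wlog h : v ≤ u generalizing u v
  · have := this hv hu (le_of_not_ge h)
    nlinarith
  have hl : 1 - (u / v)⁻¹ ≤ Real.log (u / v) := Real.one_sub_inv_le_log_of_pos (by positivity)
  rw [Real.log_div hu.ne' hv.ne', inv_div] at hl
  have h1 : (u - v) ≤ (u + v) * (Real.log u - Real.log v) := by
    have h2 : u - v = u * (1 - v / u) := by field_simp
    have h3 : 0 ≤ Real.log u - Real.log v := sub_nonneg.2 (Real.log_le_log hv h)
    have h4 := mul_le_mul_of_nonneg_left hl hu.le
    nlinarith
  nlinarith [mul_le_mul_of_nonneg_left h1 (sub_nonneg.2 h)]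

/-- A Pinsker type inequality for the entropy production. -/
lemma sq_sum_abs_sub_resample_le (hw : ∀ x, 0 ≤ w x) (hK : IsSiteKernel w i K)
    {f : (I → X) → ℝ} (hf : ∀ x, 0 ≤ f x) (hz : ZerosStable w f i) :
    (∑ x, w x * |f x - resample i K f x|) ^ 2 ≤ 2 * (∑ x, w x * f x) * entProd w i K f := by
  rw [entProd_eq hK]
  have hs : 2 * ∑ x, w x * f x = ∑ x, w x * (f x + resample i K f x) := by
    simp only [mul_add, Finset.sum_add_distrib, sum_mul_resample hK]
    ring
  have hpt : ∀ x, w x ≠ 0 → (f x - resample i K f x) ^ 2 ≤ (f x + resample i K f x) *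
      ((f x - resample i K f x) * (Real.log (f x) - Real.log (resample i K f x))) := by
    intro x hx
    by_cases h : f x = 0
    · simp [h, (resample_eq_zero_iff hK hf hz hx).2 h]
    · exact sq_sub_le_mul_log ((hf x).lt_of_ne' h) ((resample_nonneg hK hf x).lt_of_ne'
        (mt (resample_eq_zero_iff hK hf hz hx).1 h))
  rw [hs]
  refine Finset.sum_sq_le_sum_mul_sum_of_sq_le_mul _ (fun x _ => ?_) (fun x _ => ?_) (fun x _ => ?_)
  · exact mul_nonneg (hw x) (add_nonneg (hf x) (resample_nonneg hK hf x))
  · rcases eq_or_ne (w x) 0 with hx | hx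
    · simp [hx]
    refine mul_nonneg (hw x) ?_
    have h0 := (sq_nonneg _).trans (hpt x hx)
    rcases (add_nonneg (hf x) (resample_nonneg hK hf x)).eq_or_lt' with h | h
    · have h1 := hf x
      have h2 := resample_nonneg hK hf x
      have : f x = 0 := by linarith
      have : resample i K f x = 0 := by linarith
      simp [*]
    · exact nonneg_of_mul_nonneg_right h0 h
  · rcases eq_or_ne (w x) 0 with hx | hx
    · simp [hx]
    rw [mul_pow, sq_abs]
    calc w x ^ 2 * (f x - resample i K f x) ^ 2 ≤ w x ^ 2 * _ :=
          mul_le_mul_of_nonneg_left (hpt x hx) (sq_nonneg _)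
      _ = _ := by ring

end SiteKernel

end Resampling

/-! ### Dobrushin's method: comparison of two measures by their single-site kernels -/

section Dobrushin

open scoped Classical

variable {I X : Type*} [Fintype I] [Fintype X]

lemma OscLE.abs_sub_le_sum {g : (I → X) → ℝ} {δ : I → ℝ} (h : OscLE g δ) (A : Finset I) :
    ∀ x y : I → X, (∀ j ∉ A, x j = y j) → |g x - g y| ≤ ∑ j ∈ A, δ j := by
  induction A using Finset.induction_on with
  | empty =>
    intro x y hxy
    have : x = y := funext fun j => hxy j (Finset.notMem_empty j)
    simp [this]
  | insert i A hi ih =>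
    intro x y hxy
    rw [Finset.sum_insert hi]
    have h1 : |g x - g (Function.update x i (y i))| ≤ δ i := by
      rw [abs_sub_comm]
      exact h i x (y i)
    have h2 : |g (Function.update x i (y i)) - g y| ≤ ∑ j ∈ A, δ j := by
      refine ih _ _ fun j hj => ?_
      rcases eq_or_ne j i with rfl | hji
      · simp
      · simpa [hji] using hxy j (by simp [hji, hj])
    calc |g x - g y| ≤ _ := abs_sub_le _ (g (Function.update x i (y i))) _
      _ ≤ _ := add_le_add h1 h2

/-- Half the `L¹` distance of `f` from its conditional expectation given the spins off `i`. -/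
def siteDefect (q f : (I → X) → ℝ) (i : I) (K : (I → X) → X → ℝ) : ℝ :=
  1 / 2 * ∑ x, q x * |f x - resample i K f x|

/-- `b` is an *estimate* for the difference of the measures `f q` and `c q` with `c = ∑ q f`: these
two measures integrate a function with oscillations `δ` to values that differ by at most
`∑ j, b j * δ j`, and only the sites in `T` are charged. -/
structure IsEstimate (q f : (I → X) → ℝ) (T : Finset I) (b : I → ℝ) : Prop where
  nonneg : ∀ j, 0 ≤ b j
  eq_zero : ∀ j ∉ T, b j = 0
  abs_sum_le : ∀ (g : (I → X) → ℝ) (δ : I → ℝ), OscLE g δ →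
    |∑ x, q x * ((f x - ∑ y, q y * f y) * g x)| ≤ ∑ j, b j * δ j

variable {q f : (I → X) → ℝ} {T : Finset I}

lemma siteDefect_nonneg (hq : ∀ x, 0 ≤ q x) (i : I) (K : (I → X) → X → ℝ) :
    0 ≤ siteDefect q f i K :=
  mul_nonneg (by norm_num) (Finset.sum_nonneg fun x _ => mul_nonneg (hq x) (abs_nonneg _))

lemma sum_mul_sub_mean (hq1 : ∑ x, q x = 1) : ∑ x, q x * (f x - ∑ y, q y * f y) = 0 := by
  simp only [mul_sub, Finset.sum_sub_distrib, ← Finset.sum_mul, hq1, one_mul, sub_self]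

lemma exists_isEstimate (hq : ∀ x, 0 ≤ q x) (hq1 : ∑ x, q x = 1) {x₀ : I → X}
    (hT : ∀ z, q z ≠ 0 → ∀ j ∉ T, z j = x₀ j) : ∃ b, IsEstimate q f T b := by
  set c := ∑ y, q y * f y with hc
  set B := ∑ x, q x * |f x - c| with hB
  have hB0 : 0 ≤ B := Finset.sum_nonneg fun x _ => mul_nonneg (hq x) (abs_nonneg _)
  refine ⟨fun j => if j ∈ T then B else 0, fun j => ?_, fun j hj => if_neg hj, fun g δ hg => ?_⟩
  · split_ifs <;> simp [hB0]
  · have h0 : ∑ x, q x * ((f x - c) * g x) = ∑ x, q x * ((f x - c) * (g x - g x₀)) := by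
      have h1 : ∀ x, q x * ((f x - c) * (g x - g x₀)) =
          q x * ((f x - c) * g x) - q x * (f x - c) * g x₀ := fun x => by ring
      rw [Finset.sum_congr rfl fun x _ => h1 x, Finset.sum_sub_distrib, ← Finset.sum_mul,
        sum_mul_sub_mean hq1, zero_mul, sub_zero]
    rw [h0]
    calc _ ≤ ∑ x, |q x * ((f x - c) * (g x - g x₀))| := Finset.abs_sum_le_sum_abs _ _
      _ ≤ ∑ x, q x * |f x - c| * ∑ j ∈ T, δ j := by
        refine Finset.sum_le_sum fun x _ => ?_
        rcases eq_or_ne (q x) 0 with hx | hx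
        · simp [hx]
        rw [abs_mul, abs_mul, abs_of_nonneg (hq x), ← mul_assoc]
        exact mul_le_mul_of_nonneg_left (hg.abs_sub_le_sum T x x₀ (hT x hx))
          (mul_nonneg (hq x) (abs_nonneg _))
      _ = _ := by
        rw [← Finset.sum_mul, ← hB, Finset.mul_sum]
        simp

/-- Resampling the spin at one site improves an estimate at this site. -/
lemma IsEstimate.abs_le_resample (hq : ∀ x, 0 ≤ q x) {i : I} {K : (I → X) → X → ℝ}
    (hK : IsSiteKernel q i K) {r : I → ℝ} (hr0 : r i = 0)
    (hr : ∀ j x a, dTV (K (Function.update x j a)) (K x) ≤ r j)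
    {b : I → ℝ} (hb : IsEstimate q f T b) {g : (I → X) → ℝ} {δ : I → ℝ} (hg : OscLE g δ) :
    |∑ x, q x * ((f x - ∑ y, q y * f y) * g x)| ≤
      ∑ j, b j * δ j + (siteDefect q f i K + ∑ j, r j * b j - b i) * δ i := by
  set c := ∑ y, q y * f y with hc
  have h1 := abs_sum_sub_resample_mul_le hq hK f hg
  have h2 := hb.abs_sum_le _ _ (hg.resample hK hr)
  rw [← hc] at h2
  have hsplit : ∑ x, q x * ((f x - c) * g x) =
      ∑ x, q x * ((f x - resample i K f x) * g x) +
      ∑ x, q x * ((f x - c) * resample i K g x) := by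
    have e1 : ∀ x, q x * ((f x - resample i K f x) * g x) + q x * ((f x - c) * resample i K g x) =
        q x * ((f x - c) * g x) + (q x * (f x * resample i K g x) -
          q x * (resample i K f x * g x)) + c * (q x * g x - q x * resample i K g x) := by
      intro x
      ring
    rw [← Finset.sum_add_distrib, Finset.sum_congr rfl fun x _ => e1 x, Finset.sum_add_distrib,
      Finset.sum_add_distrib, ← Finset.mul_sum, Finset.sum_sub_distrib, Finset.sum_sub_distrib,
      sum_mul_resample_comm hK, sum_mul_resample hK]
    ring
  have h3 : ∑ j, b j * (if j = i then 0 else δ j + r j * δ i) =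
      ∑ j, b j * δ j + (∑ j, r j * b j - b i) * δ i := by
    have e2 : ∀ j, b j * (if j = i then 0 else δ j + r j * δ i) =
        b j * δ j + r j * b j * δ i - if j = i then b j * δ i else 0 := by
      intro j
      split_ifs with h
      · subst h
        rw [hr0]
        ring
      · ring
    rw [Finset.sum_congr rfl fun j _ => e2 j, Finset.sum_sub_distrib, Finset.sum_add_distrib,
      ← Finset.sum_mul, Finset.sum_ite_eq' Finset.univ i, if_pos (Finset.mem_univ i)]
    ring
  rw [h3] at h2
  rw [hsplit]
  refine (abs_add_le _ _).trans ((add_le_add h1 h2).trans (le_of_eq ?_))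
  rw [siteDefect]
  ring

/-- Averaging the one-site improvements over `T` gives a new estimate. -/
lemma IsEstimate.improve (hq : ∀ x, 0 ≤ q x) {Q : I → (I → X) → X → ℝ} {J : Matrix I I ℝ}
    (hK : ∀ i ∈ T, IsSiteKernel q i (Q i)) (hJ0 : ∀ i, J i i = 0)
    (hJ : ∀ i j x a, dTV (Q i (Function.update x j a)) (Q i x) ≤ J i j)
    (hJnn : ∀ i j, 0 ≤ J i j) (hTne : T.Nonempty)
    {b : I → ℝ} (hb : IsEstimate q f T b) :
    IsEstimate q f T fun j => if j ∈ T then (1 - (T.card : ℝ)⁻¹) * b j +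
      (T.card : ℝ)⁻¹ * (siteDefect q f j (Q j) + ∑ k, J j k * b k) else 0 := by
  have hm : (1 : ℝ) ≤ T.card := by exact_mod_cast hTne.card_pos
  have hm0 : (0 : ℝ) < T.card := by linarith
  have hm1 : (T.card : ℝ)⁻¹ ≤ 1 := inv_le_one_of_one_le₀ hm
  refine ⟨fun j => ?_, fun j hj => if_neg hj, fun g δ hg => ?_⟩
  · split_ifs
    · refine add_nonneg (mul_nonneg (by linarith) (hb.nonneg j)) (mul_nonneg (by positivity) ?_)
      exact add_nonneg (siteDefect_nonneg hq _ _)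
        (Finset.sum_nonneg fun k _ => mul_nonneg (hJnn j k) (hb.nonneg k))
    · exact le_rfl
  · set E := |∑ x, q x * ((f x - ∑ y, q y * f y) * g x)|
    have h1 : ∑ i ∈ T, E ≤ ∑ i ∈ T, (∑ j, b j * δ j +
        (siteDefect q f i (Q i) + ∑ j, J i j * b j - b i) * δ i) :=
      Finset.sum_le_sum fun i hi => hb.abs_le_resample hq (hK i hi) (hJ0 i) (hJ i) hg
    rw [Finset.sum_const, nsmul_eq_mul, Finset.sum_add_distrib, Finset.sum_const, nsmul_eq_mul] at h1
    have h2 : ∑ j, b j * δ j = ∑ j ∈ T, b j * δ j := by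
      refine (Finset.sum_subset (Finset.subset_univ T) fun j _ hj => ?_).symm
      rw [hb.eq_zero j hj, zero_mul]
    have h3 : ∑ j, (if j ∈ T then (1 - (T.card : ℝ)⁻¹) * b j +
        (T.card : ℝ)⁻¹ * (siteDefect q f j (Q j) + ∑ k, J j k * b k) else 0) * δ j =
        ∑ j ∈ T, b j * δ j + (T.card : ℝ)⁻¹ *
          ∑ i ∈ T, (siteDefect q f i (Q i) + ∑ j, J i j * b j - b i) * δ i := by
      rw [Finset.mul_sum, ← Finset.sum_add_distrib]
      simp only [ite_mul, zero_mul, Finset.sum_ite_mem, Finset.univ_inter]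
      refine Finset.sum_congr rfl fun j _ => ?_
      ring
    rw [h3, ← h2]
    refine le_of_mul_le_mul_left (h1.trans (le_of_eq ?_)) hm0
    rw [mul_add, mul_inv_cancel_left₀ hm0.ne']

lemma norm_toLp_le_of_abs_le {u v : I → ℝ} (h : ∀ i, |u i| ≤ |v i|) :
    ‖WithLp.toLp 2 u‖ ≤ ‖WithLp.toLp 2 v‖ := by
  rw [EuclideanSpace.norm_eq, EuclideanSpace.norm_eq]
  refine Real.sqrt_le_sqrt (Finset.sum_le_sum fun i _ => ?_)
  simpa using sq_le_sq.2 (h i)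

lemma norm_toLp_mulVec_le (J : Matrix I I ℝ) (v : I → ℝ) :
    ‖WithLp.toLp 2 (J.mulVec v)‖ ≤ norm22 J * ‖WithLp.toLp 2 v‖ := by
  have h := (Matrix.toEuclideanCLM (𝕜 := ℝ) J).le_opNorm (WithLp.toLp 2 v)
  rwa [Matrix.toEuclideanCLM_toLp] at h

/-- Among all estimates, the infimum of the Euclidean norms is at most `‖t‖ / α`, where `t` is the
vector of one-site defects: otherwise improving a nearly optimal estimate would go below it. -/
lemma exists_isEstimate_norm_le (hq : ∀ x, 0 ≤ q x) (hq1 : ∑ x, q x = 1) {x₀ : I → X}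
    (hT : ∀ z, q z ≠ 0 → ∀ j ∉ T, z j = x₀ j) {Q : I → (I → X) → X → ℝ} {J : Matrix I I ℝ}
    (hK : ∀ i ∈ T, IsSiteKernel q i (Q i)) (hJ0 : ∀ i, J i i = 0)
    (hJ : ∀ i j x a, dTV (Q i (Function.update x j a)) (Q i x) ≤ J i j)
    (hJnn : ∀ i j, 0 ≤ J i j) (hTne : T.Nonempty) {α : ℝ} (hJα : norm22 J ≤ 1 - α)
    {ε : ℝ} (hε : 0 < ε) :
    ∃ b, IsEstimate q f T b ∧ α * ‖WithLp.toLp 2 b‖ ≤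
      ‖WithLp.toLp 2 fun j => if j ∈ T then siteDefect q f j (Q j) else 0‖ + ε := by
  set t : I → ℝ := fun j => if j ∈ T then siteDefect q f j (Q j) else 0 with ht
  have hm : (1 : ℝ) ≤ T.card := by exact_mod_cast hTne.card_pos
  set s : ℝ := (T.card : ℝ)⁻¹ with hs
  have hs0 : 0 < s := by positivity
  have hs1 : s ≤ 1 := inv_le_one_of_one_le₀ hm
  have hstep : ∀ b, IsEstimate q f T b → ∃ b', IsEstimate q f T b' ∧
      ‖WithLp.toLp 2 b'‖ ≤ (1 - s * α) * ‖WithLp.toLp 2 b‖ + s * ‖WithLp.toLp 2 t‖ := by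
    intro b hb
    refine ⟨_, hb.improve hq hK hJ0 hJ hJnn hTne, ?_⟩
    have h1 : ‖WithLp.toLp 2 fun j => if j ∈ T then (1 - s) * b j +
        s * (siteDefect q f j (Q j) + ∑ k, J j k * b k) else 0‖ ≤
        ‖WithLp.toLp 2 ((1 - s) • b + s • (t + J.mulVec b))‖ := by
      refine norm_toLp_le_of_abs_le fun j => ?_
      split_ifs with hj
      · refine le_of_eq (congrArg _ ?_)
        simp [ht, hj, Matrix.mulVec, dotProduct, mul_add]
      · simp
    refine h1.trans ?_
    rw [WithLp.toLp_add, WithLp.toLp_smul, WithLp.toLp_smul, WithLp.toLp_add]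
    have hJb := norm_toLp_mulVec_le J b
    have h2 : norm22 J * ‖WithLp.toLp 2 b‖ ≤ (1 - α) * ‖WithLp.toLp 2 b‖ :=
      mul_le_mul_of_nonneg_right hJα (norm_nonneg _)
    calc _ ≤ ‖(1 - s) • WithLp.toLp 2 b‖ + ‖s • (WithLp.toLp 2 t + WithLp.toLp 2 (J.mulVec b))‖ :=
          norm_add_le _ _
      _ ≤ (1 - s) * ‖WithLp.toLp 2 b‖ +
          s * (‖WithLp.toLp 2 t‖ + (1 - α) * ‖WithLp.toLp 2 b‖) := by
        rw [norm_smul, norm_smul, Real.norm_of_nonneg hs0.le,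
          Real.norm_of_nonneg (sub_nonneg.2 hs1)]
        gcongr
        exact (norm_add_le _ _).trans (add_le_add le_rfl (hJb.trans h2))
      _ = _ := by ring
  set M : Set ℝ := (fun b : I → ℝ => ‖WithLp.toLp 2 b‖) '' {b | IsEstimate q f T b} with hM
  obtain ⟨b₀, hb₀⟩ := exists_isEstimate (f := f) hq hq1 hT
  have hMne : M.Nonempty := ⟨_, b₀, hb₀, rfl⟩
  have hMbdd : BddBelow M := ⟨0, by rintro _ ⟨b, _, rfl⟩; exact norm_nonneg _⟩
  have hlt : sInf M < sInf M + s * ε := by nlinarith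
  obtain ⟨_, ⟨b, hb, rfl⟩, hbM⟩ := exists_lt_of_csInf_lt hMne hlt
  obtain ⟨b', hb', hbb'⟩ := hstep b hb
  have hle : sInf M ≤ ‖WithLp.toLp 2 b'‖ := csInf_le hMbdd ⟨b', hb', rfl⟩
  refine ⟨b, hb, ?_⟩
  have : s * (α * ‖WithLp.toLp 2 b‖) ≤ s * (‖WithLp.toLp 2 t‖ + ε) := by
    dsimp only at hbM
    nlinarith
  exact le_of_mul_le_mul_left this hs0

/-- The total variation distance of the laws of the spin at `i` under `f q` and `c q`, where
`c = ∑ q f`. -/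
def siteTV (q f : (I → X) → ℝ) (i : I) : ℝ :=
  1 / 2 * ∑ a, |∑ x, if x i = a then q x * (f x - ∑ y, q y * f y) else 0|

lemma IsEstimate.siteTV_le {b : I → ℝ} (hb : IsEstimate q f T b) (i : I) :
    siteTV q f i ≤ b i := by
  set c := ∑ y, q y * f y with hc
  set d : X → ℝ := fun a => ∑ x, if x i = a then q x * (f x - c) else 0 with hd
  let g : (I → X) → ℝ := fun x => 1 / 2 * (SignType.sign (d (x i)) : ℝ)
  have hsign : ∀ r : ℝ, |(SignType.sign r : ℝ)| ≤ 1 := by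
    intro r
    rcases lt_trichotomy r 0 with h | h | h <;> simp [h]
  have hg : OscLE g fun j => if j = i then 1 else 0 := by
    intro j x a
    dsimp only
    split_ifs with h
    · subst h
      have h1 := abs_le.1 (hsign (d a))
      have h2 := abs_le.1 (hsign (d (x j)))
      simp only [g, Function.update_self]
      rw [abs_le]
      constructor <;> linarith
    · simp [g, Function.update_of_ne (Ne.symm h)]
  have h := hb.abs_sum_le g _ hg
  simp only [mul_ite, mul_one, mul_zero, Finset.sum_ite_eq', Finset.mem_univ, if_true] at h
  refine le_trans (le_of_eq ?_) ((le_abs_self _).trans h)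
  have h1 : ∑ a, |d a| = ∑ a, ∑ x, if x i = a then q x * (f x - c) * SignType.sign (d a) else 0 := by
    refine Finset.sum_congr rfl fun a _ => ?_
    rw [← self_mul_sign (d a), hd, Finset.sum_mul]
    refine Finset.sum_congr rfl fun x _ => ?_
    split_ifs <;> simp
  rw [siteTV, ← hc, h1, Finset.sum_comm, Finset.mul_sum]
  refine Finset.sum_congr rfl fun x _ => ?_
  simp only [Finset.sum_ite_eq, Finset.mem_univ, if_true, g]
  ring

/-- Dobrushin comparison: the one-site marginals are controlled by the one-site defects. -/
lemma sum_siteTV_sq_le (hq : ∀ x, 0 ≤ q x) (hq1 : ∑ x, q x = 1) {x₀ : I → X}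
    (hT : ∀ z, q z ≠ 0 → ∀ j ∉ T, z j = x₀ j) {Q : I → (I → X) → X → ℝ} {J : Matrix I I ℝ}
    (hK : ∀ i ∈ T, IsSiteKernel q i (Q i)) (hJ0 : ∀ i, J i i = 0)
    (hJ : ∀ i j x a, dTV (Q i (Function.update x j a)) (Q i x) ≤ J i j)
    (hJnn : ∀ i j, 0 ≤ J i j) {α : ℝ} (hα : 0 < α) (hJα : norm22 J ≤ 1 - α) :
    α ^ 2 * ∑ i ∈ T, siteTV q f i ^ 2 ≤ ∑ i ∈ T, siteDefect q f i (Q i) ^ 2 := by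
  rcases T.eq_empty_or_nonempty with rfl | hTne
  · simp
  set t : I → ℝ := fun j => if j ∈ T then siteDefect q f j (Q j) else 0 with ht
  set v : I → ℝ := fun j => if j ∈ T then siteTV q f j else 0 with hv
  have hTV : ∀ i, 0 ≤ siteTV q f i := fun i =>
    mul_nonneg (by norm_num) (Finset.sum_nonneg fun a _ => abs_nonneg _)
  have hle : α * ‖WithLp.toLp 2 v‖ ≤ ‖WithLp.toLp 2 t‖ := by
    refine le_of_forall_pos_le_add fun ε hε => ?_
    obtain ⟨b, hb, hbt⟩ := exists_isEstimate_norm_le (f := f) hq hq1 hT hK hJ0 hJ hJnn hTne hJα hε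
    refine le_trans (mul_le_mul_of_nonneg_left (norm_toLp_le_of_abs_le fun i => ?_) hα.le) hbt
    simp only [hv]
    split_ifs
    · rw [abs_of_nonneg (hTV i), abs_of_nonneg (hb.nonneg i)]
      exact hb.siteTV_le i
    · simp
  have hsq := pow_le_pow_left₀ (mul_nonneg hα.le (norm_nonneg _)) hle 2
  rw [mul_pow, EuclideanSpace.real_norm_sq_eq, EuclideanSpace.real_norm_sq_eq] at hsq
  simpa [ht, hv, ite_pow] using hsq

end Dobrushin

/-! ### Entropy of one spin against total variation -/

section OneSite

open scoped Classical

variable {I X : Type*} [Fintype I] [Fintype X]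

lemma mul_log_sub_mul_log_le {u c : ℝ} (hu : 0 ≤ u) (hc : 0 < c) :
    u * Real.log u - c * Real.log c ≤ (u - c) * (Real.log c + 1) + (u - c) ^ 2 / c := by
  rcases hu.eq_or_lt with rfl | hu
  · have : (0 - c) ^ 2 / c = c := by field_simp; ring
    rw [this]
    simp
    linarith
  · have h := Real.log_le_sub_one_of_pos (div_pos hu hc)
    rw [Real.log_div hu.ne' hc.ne'] at h
    have h1 := mul_le_mul_of_nonneg_left h hu.le
    have h2 : (u - c) ^ 2 / c = u * (u / c - 1) - (u - c) := by field_simp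
    rw [h2]
    nlinarith

lemma sum_sq_le_of_sum_eq_zero {d : X → ℝ} (hd : ∑ a, d a = 0) :
    ∑ a, d a ^ 2 ≤ 2 * (1 / 2 * ∑ a, |d a|) ^ 2 := by
  have h1 : ∀ a, 2 * |d a| ≤ ∑ b, |d b| := by
    intro a
    rw [← Finset.add_sum_erase _ _ (Finset.mem_univ a)] at hd ⊢
    have h2 : |d a| = |∑ b ∈ Finset.univ.erase a, d b| := by
      rw [eq_neg_of_add_eq_zero_left hd, abs_neg]
    have h3 := Finset.abs_sum_le_sum_abs d (Finset.univ.erase a)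
    linarith
  calc ∑ a, d a ^ 2 ≤ ∑ a, |d a| * (1 / 2 * ∑ b, |d b|) := by
        refine Finset.sum_le_sum fun a _ => ?_
        rw [← sq_abs, sq]
        exact mul_le_mul_of_nonneg_left (by linarith [h1 a]) (abs_nonneg _)
    _ = _ := by rw [← Finset.sum_mul]; ring

/-- The mass that the weight `q` gives to the event that the spin at `i` is `a`. -/
def siteMass (q : (I → X) → ℝ) (i : I) (a : X) : ℝ := ∑ x, if x i = a then q x else 0

lemma sum_mul_comp_site (q : (I → X) → ℝ) (i : I) (h : X → ℝ) :
    ∑ x, q x * h (x i) = ∑ a, siteMass q i a * h a := by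
  simp only [siteMass, Finset.sum_mul, ite_mul, zero_mul]
  rw [Finset.sum_comm]
  simp

variable {q f : (I → X) → ℝ}

lemma siteMass_nonneg (hq : ∀ x, 0 ≤ q x) (i : I) (a : X) : 0 ≤ siteMass q i a :=
  Finset.sum_nonneg fun x _ => by split_ifs <;> simp [hq]

lemma siteMass_mul_eq_zero (hq : ∀ x, 0 ≤ q x) {i : I} {a : X} (h : siteMass q i a = 0) :
    siteMass (fun x => q x * f x) i a = 0 := by
  refine Finset.sum_eq_zero fun x _ => ?_
  have h1 := (Finset.sum_eq_zero_iff_of_nonneg fun x _ => by split_ifs <;> simp [hq]).1 h x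
    (Finset.mem_univ x)
  split_ifs at h1 ⊢ <;> simp [h1]

lemma siteTV_eq (q f : (I → X) → ℝ) (i : I) :
    siteTV q f i = 1 / 2 * ∑ a, |siteMass (fun x => q x * f x) i a -
      (∑ y, q y * f y) * siteMass q i a| := by
  refine congrArg _ (Finset.sum_congr rfl fun a _ => congrArg _ ?_)
  rw [siteMass, siteMass, Finset.mul_sum, ← Finset.sum_sub_distrib]
  refine Finset.sum_congr rfl fun x _ => ?_
  split_ifs <;> ring

/-- A reverse Pinsker inequality: the relative entropy of the laws of the spin at `i` under `f q`
and `q` is at most a multiple of their squared total variation distance, if the second law has no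
small atoms. -/
lemma sum_siteMass_entropy_le (hq : ∀ x, 0 ≤ q x) (hq1 : ∑ x, q x = 1) (hf : ∀ x, 0 ≤ f x)
    (hc : 0 < ∑ y, q y * f y) {i : I} {α : ℝ} (hα : 0 < α)
    (hatom : ∀ a, siteMass q i a ≠ 0 → α ≤ siteMass q i a) :
    ∑ x, q x * ((siteMass (fun x => q x * f x) i (x i) / siteMass q i (x i)) *
      Real.log (siteMass (fun x => q x * f x) i (x i) / siteMass q i (x i)) -
      (∑ y, q y * f y) * Real.log (∑ y, q y * f y)) ≤
      2 / ((∑ y, q y * f y) * α) * siteTV q f i ^ 2 := by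
  rw [siteTV_eq]
  set c := ∑ y, q y * f y with hc_def
  set p : X → ℝ := siteMass (fun x => q x * f x) i with hp
  set m : X → ℝ := siteMass q i with hm
  have hd : ∑ a, (p a - c * m a) = 0 := by
    have h1 := sum_mul_comp_site q i fun _ => 1
    have h2 := sum_mul_comp_site (fun x => q x * f x) i fun _ => 1
    simp only [mul_one] at h1 h2
    rw [Finset.sum_sub_distrib, ← Finset.mul_sum, hp, hm, ← h1, ← h2, hq1, mul_one, sub_self]
  rw [sum_mul_comp_site q i fun a => p a / m a * Real.log (p a / m a) - c * Real.log c]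
  calc _ ≤ ∑ a, ((p a - c * m a) * (Real.log c + 1) + (p a - c * m a) ^ 2 * (c * α)⁻¹) := by
        refine Finset.sum_le_sum fun a _ => ?_
        change m a * _ ≤ _
        rcases eq_or_ne (m a) 0 with h | h
        · have hpa : p a = 0 := siteMass_mul_eq_zero hq h
          simp [h, hpa]
        have hm0 : 0 < m a := hα.trans_le (hatom a h)
        have hp0 : 0 ≤ p a := siteMass_nonneg (fun x => mul_nonneg (hq x) (hf x)) i a
        have h1 := mul_le_mul_of_nonneg_left
          (mul_log_sub_mul_log_le (div_nonneg hp0 hm0.le) hc) hm0.le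
        refine h1.trans ?_
        have h2 : m a * ((p a / m a - c) * (Real.log c + 1) + (p a / m a - c) ^ 2 / c) =
            (p a - c * m a) * (Real.log c + 1) + (p a - c * m a) ^ 2 * (c * m a)⁻¹ := by
          field_simp
        rw [h2]
        gcongr
        exact hatom a h
    _ = (∑ a, (p a - c * m a) ^ 2) * (c * α)⁻¹ := by
        rw [Finset.sum_add_distrib, ← Finset.sum_mul, ← Finset.sum_mul, hd, zero_mul, zero_add]
    _ ≤ 2 * (1 / 2 * ∑ a, |p a - c * m a|) ^ 2 * (c * α)⁻¹ :=
        mul_le_mul_of_nonneg_right (sum_sq_le_of_sum_eq_zero hd) (by positivity)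
    _ = _ := by ring

end OneSite

/-! ### Conditioning on the spins in a set of sites -/

section Pinning

open scoped Classical

variable {I X : Type*} [Fintype I] [Fintype X]

/-- The total weight of the configurations that agree with `x` on `S`. -/
def cylMass (w : (I → X) → ℝ) (S : Finset I) (x : I → X) : ℝ :=
  ∑ z, if ∀ j ∈ S, z j = x j then w z else 0

/-- The weight `w` conditioned on the event that the spins in `S` are those of `x`. -/
def pin (w : (I → X) → ℝ) (S : Finset I) (x z : I → X) : ℝ :=
  if ∀ j ∈ S, z j = x j then w z / cylMass w S x else 0

/-- The conditional expectation of `f` given the spins in `S`. -/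
def condExpect (w f : (I → X) → ℝ) (S : Finset I) (x : I → X) : ℝ :=
  cylMass (fun z => w z * f z) S x / cylMass w S x

variable {w f : (I → X) → ℝ}

lemma cylMass_congr (w : (I → X) → ℝ) {S : Finset I} {x y : I → X} (h : ∀ j ∈ S, x j = y j) :
    cylMass w S x = cylMass w S y := by
  refine Finset.sum_congr rfl fun z _ => if_congr ?_ rfl rfl
  exact forall₂_congr fun j hj => by rw [h j hj]

lemma cylMass_nonneg (hw : ∀ x, 0 ≤ w x) (S : Finset I) (x : I → X) : 0 ≤ cylMass w S x :=
  Finset.sum_nonneg fun z _ => by split_ifs <;> simp [hw]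

lemma cylMass_pos (hw : ∀ x, 0 ≤ w x) (S : Finset I) {x : I → X} (hx : w x ≠ 0) :
    0 < cylMass w S x := by
  have h := Finset.single_le_sum (f := fun z => if ∀ j ∈ S, z j = x j then w z else 0)
    (fun z _ => by split_ifs <;> simp [hw]) (Finset.mem_univ x)
  simp only [implies_true, if_true] at h
  exact ((hw x).lt_of_ne' hx).trans_le h

lemma pin_nonneg (hw : ∀ x, 0 ≤ w x) (S : Finset I) (x z : I → X) : 0 ≤ pin w S x z := by
  unfold pin
  split_ifs
  · exact div_nonneg (hw z) (cylMass_nonneg hw S x)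
  · exact le_rfl

lemma sum_pin_mul (w g : (I → X) → ℝ) (S : Finset I) (x : I → X) :
    ∑ z, pin w S x z * g z = condExpect w g S x := by
  rw [condExpect, cylMass, Finset.sum_div]
  refine Finset.sum_congr rfl fun z _ => ?_
  unfold pin
  split_ifs <;> ring

lemma sum_pin (hw : ∀ x, 0 ≤ w x) (S : Finset I) {x : I → X} (hx : w x ≠ 0) :
    ∑ z, pin w S x z = 1 := by
  have h := sum_pin_mul w (fun _ => 1) S x
  simp only [mul_one] at h
  rw [h, condExpect]
  simp only [mul_one]
  exact div_self (cylMass_pos hw S hx).ne'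

lemma pin_ne_zero {S : Finset I} {x z : I → X} (h : pin w S x z ≠ 0) :
    (∀ j ∈ S, z j = x j) ∧ w z ≠ 0 := by
  unfold pin at h
  split_ifs at h with h1
  · exact ⟨h1, fun h2 => h (by rw [h2, zero_div])⟩
  · exact absurd rfl h

/-- The law of total expectation. -/
lemma sum_mul_sum_pin (hw : ∀ x, 0 ≤ w x) (S : Finset I) (k : (I → X) → ℝ) :
    ∑ x, w x * ∑ z, pin w S x z * k z = ∑ z, w z * k z := by
  simp only [Finset.mul_sum]
  rw [Finset.sum_comm]
  refine Finset.sum_congr rfl fun z _ => ?_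
  rcases eq_or_ne (w z) 0 with hz | hz
  · simp [pin, hz]
  have h1 : ∀ x, w x * (pin w S x z * k z) =
      (w z * k z / cylMass w S z) * if ∀ j ∈ S, x j = z j then w x else 0 := by
    intro x
    by_cases h : ∀ j ∈ S, z j = x j
    · have h' : ∀ j ∈ S, x j = z j := fun j hj => (h j hj).symm
      rw [pin, if_pos h, if_pos h', cylMass_congr w h]
      ring
    · have h' : ¬ ∀ j ∈ S, x j = z j := fun h2 => h fun j hj => (h2 j hj).symm
      rw [pin, if_neg h, if_neg h']
      ring
  rw [Finset.sum_congr rfl fun x _ => h1 x, ← Finset.mul_sum]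
  exact div_mul_cancel₀ _ (cylMass_pos hw S hz).ne'

lemma IsSiteKernel.pin {i : I} {K : (I → X) → X → ℝ} (hK : IsSiteKernel w i K) {S : Finset I}
    (hi : i ∉ S) (x : I → X) : IsSiteKernel (pin w S x) i K where
  nonneg := hK.nonneg
  sum_eq_one := hK.sum_eq_one
  update_eq := hK.update_eq
  balance z a := by
    have h : ∀ b, (∀ j ∈ S, Function.update z i b j = x j) ↔ ∀ j ∈ S, z j = x j := by
      refine fun b => forall₂_congr fun j hj => ?_
      rw [Function.update_of_ne (ne_of_mem_of_not_mem hj hi)]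
    simp only [SpinSystem.pin, h]
    split_ifs
    · rw [← Finset.sum_div, hK.balance, mul_div_assoc]
    · simp

lemma siteMass_pin (w g : (I → X) → ℝ) (S : Finset I) (i : I) {x z : I → X}
    (hz : ∀ j ∈ S, z j = x j) :
    siteMass (fun y => pin w S x y * g y) i (z i) =
      cylMass (fun y => w y * g y) (insert i S) z / cylMass w S x := by
  rw [siteMass, cylMass, Finset.sum_div]
  refine Finset.sum_congr rfl fun y _ => ?_
  simp only [Finset.forall_mem_insert]
  by_cases h1 : y i = z i
  · by_cases h2 : ∀ j ∈ S, y j = z j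
    · have h3 : ∀ j ∈ S, y j = x j := fun j hj => (h2 j hj).trans (hz j hj)
      rw [if_pos h1, if_pos ⟨h1, h2⟩, pin, if_pos h3]
      ring
    · have h3 : ¬ ∀ j ∈ S, y j = x j := fun h3 => h2 fun j hj => (h3 j hj).trans (hz j hj).symm
      rw [if_pos h1, if_neg (fun h => h2 h.2), pin, if_neg h3]
      ring
  · rw [if_neg h1, if_neg (fun h => h1 h.1), zero_div]

lemma siteMass_pin_one (w : (I → X) → ℝ) (S : Finset I) (i : I) {x z : I → X}
    (hz : ∀ j ∈ S, z j = x j) :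
    siteMass (pin w S x) i (z i) = cylMass w (insert i S) z / cylMass w S x := by
  simpa using siteMass_pin w (fun _ => 1) S i hz

lemma siteMass_pin_div (hw : ∀ x, 0 ≤ w x) {S : Finset I} (i : I) {x z : I → X} (hx : w x ≠ 0)
    (hz : ∀ j ∈ S, z j = x j) :
    siteMass (fun y => pin w S x y * f y) i (z i) / siteMass (pin w S x) i (z i) =
      condExpect w f (insert i S) z := by
  rw [siteMass_pin w f S i hz, siteMass_pin_one w S i hz, condExpect,
    div_div_div_cancel_right₀ (cylMass_pos hw S hx).ne']

lemma ZerosStable.pin {i : I} (hz : ZerosStable w f i) (S : Finset I) (x : I → X) :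
    ZerosStable (pin w S x) f i := fun _ a h1 h2 h3 =>
  hz _ a (pin_ne_zero h1).2 (pin_ne_zero h2).2 h3

lemma sum_mul_entProd_pin (hw : ∀ x, 0 ≤ w x) (S : Finset I) (i : I) (K : (I → X) → X → ℝ) :
    ∑ x, w x * entProd (pin w S x) i K f = entProd w i K f :=
  sum_mul_sum_pin hw S _

/-- `E [φ (E [f | x_S])]` with `φ u = u log u`.  For `S = ∅` and for all of `I` these are the two
terms of the entropy of `f`. -/
def partialEnt (w f : (I → X) → ℝ) (S : Finset I) : ℝ :=
  ∑ x, w x * (condExpect w f S x * Real.log (condExpect w f S x))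

section ApproximateTensorization

variable {Q : I → (I → X) → X → ℝ} {J : Matrix I I ℝ} {α₁ α₂ : ℝ}

/-- Summed over the sites `i` off `S`, the entropy of the spin at `i` in the measure pinned on `S`
is controlled by the entropy productions. -/
lemma sum_pin_entropy_le (hw : ∀ x, 0 ≤ w x) (hf : ∀ x, 0 ≤ f x)
    (hα₁ : 0 < α₁) (hα₂ : 0 < α₂)
    (hβ : ∀ (S : Finset I) (i : I) (z : I → X), i ∉ S → w z ≠ 0 →
      α₁ ≤ cylMass w (insert i S) z / cylMass w S z)
    (hK : ∀ i, IsSiteKernel w i (Q i)) (hJ0 : ∀ i, J i i = 0)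
    (hJ : ∀ i j x a, dTV (Q i (Function.update x j a)) (Q i x) ≤ J i j)
    (hJnn : ∀ i j, 0 ≤ J i j) (hJα : norm22 J ≤ 1 - α₂) (hz : ∀ i, ZerosStable w f i)
    (S : Finset I) {x : I → X} (hx : w x ≠ 0) :
    ∑ i ∈ Sᶜ, ∑ z, pin w S x z *
      (condExpect w f (insert i S) z * Real.log (condExpect w f (insert i S) z) -
        condExpect w f S x * Real.log (condExpect w f S x)) ≤
      α₁⁻¹ * (α₂ ^ 2)⁻¹ * ∑ i ∈ Sᶜ, entProd (pin w S x) i (Q i) f := by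
  set q := pin w S x with hq_def
  have hq : ∀ z, 0 ≤ q z := pin_nonneg hw S x
  have hq1 : ∑ z, q z = 1 := sum_pin hw S hx
  have hmean : condExpect w f S x = ∑ z, q z * f z := (sum_pin_mul w f S x).symm
  have hKq : ∀ i ∈ Sᶜ, IsSiteKernel q i (Q i) := fun i hi =>
    (hK i).pin (Finset.mem_compl.1 hi) x
  have hc0 : 0 ≤ ∑ z, q z * f z := Finset.sum_nonneg fun z _ => mul_nonneg (hq z) (hf z)
  have hcond : ∀ i z, q z * (condExpect w f (insert i S) z *
      Real.log (condExpect w f (insert i S) z) -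
        condExpect w f S x * Real.log (condExpect w f S x)) =
      q z * ((siteMass (fun y => q y * f y) i (z i) / siteMass q i (z i)) *
        Real.log (siteMass (fun y => q y * f y) i (z i) / siteMass q i (z i)) -
        (∑ y, q y * f y) * Real.log (∑ y, q y * f y)) := by
    intro i z
    rcases eq_or_ne (q z) 0 with h | h
    · rw [h, zero_mul, zero_mul]
    · rw [siteMass_pin_div hw i hx (pin_ne_zero h).1, hmean]
  simp only [hcond]
  rcases hc0.eq_or_lt with hc | hc
  · have h0 : ∀ z, q z * f z = 0 := fun z =>
      (Finset.sum_eq_zero_iff_of_nonneg fun z _ => mul_nonneg (hq z) (hf z)).1 hc.symm z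
        (Finset.mem_univ z)
    simp [entProd, ← mul_assoc, h0, siteMass]
  · set c := ∑ z, q z * f z with hc_def
    have h1 : ∀ i ∈ Sᶜ, siteDefect q f i (Q i) ^ 2 ≤ c / 2 * entProd q i (Q i) f := by
      intro i hi
      have := sq_sum_abs_sub_resample_le hq (hKq i hi) hf ((hz i).pin S x)
      rw [← hc_def] at this
      rw [siteDefect, mul_pow]
      linarith
    have h2 := sum_siteTV_sq_le (f := f) (T := Sᶜ) (x₀ := x) hq hq1
      (fun z hz j hj => (pin_ne_zero hz).1 j (by simpa using hj)) hKq hJ0 hJ hJnn hα₂ hJα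
    have h3 := h2.trans (Finset.sum_le_sum h1)
    rw [← Finset.mul_sum] at h3
    calc _ ≤ ∑ i ∈ Sᶜ, 2 / (c * α₁) * siteTV q f i ^ 2 := by
          refine Finset.sum_le_sum fun i hi => ?_
          refine sum_siteMass_entropy_le hq hq1 hf hc hα₁ fun a ha => ?_
          obtain ⟨z, _, hz⟩ := Finset.exists_ne_zero_of_sum_ne_zero ha
          rw [ite_ne_right_iff] at hz
          obtain ⟨rfl, hqz⟩ := hz
          obtain ⟨hzS, hwz⟩ := pin_ne_zero hqz
          rw [hq_def, siteMass_pin_one w S i hzS, ← cylMass_congr w hzS]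
          exact hβ S i z (Finset.mem_compl.1 hi) hwz
      _ = 2 / (c * α₁) * (α₂ ^ 2)⁻¹ * (α₂ ^ 2 * ∑ i ∈ Sᶜ, siteTV q f i ^ 2) := by
          rw [← Finset.mul_sum]
          field_simp
      _ ≤ 2 / (c * α₁) * (α₂ ^ 2)⁻¹ * (c / 2 * ∑ i ∈ Sᶜ, entProd q i (Q i) f) :=
          mul_le_mul_of_nonneg_left h3 (by positivity)
      _ = _ := by field_simp

lemma partialEnt_univ (f : (I → X) → ℝ) :
    partialEnt w f Finset.univ = ∑ x, w x * (f x * Real.log (f x)) := by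
  refine Finset.sum_congr rfl fun x _ => ?_
  rcases eq_or_ne (w x) 0 with h | h
  · simp [h]
  have h1 : ∀ g : (I → X) → ℝ, cylMass g Finset.univ x = g x := by
    intro g
    simp [cylMass, ← funext_iff]
  rw [condExpect, h1, h1, mul_div_cancel_left₀ _ h]

lemma partialEnt_empty (hw1 : ∑ x, w x = 1) (f : (I → X) → ℝ) :
    partialEnt w f ∅ = (∑ x, w x * f x) * Real.log (∑ x, w x * f x) := by
  simp [partialEnt, condExpect, cylMass, hw1, ← Finset.sum_mul]

lemma sum_partialEnt_insert_sub_le (hw : ∀ x, 0 ≤ w x) (hf : ∀ x, 0 ≤ f x)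
    (hα₁ : 0 < α₁) (hα₂ : 0 < α₂)
    (hβ : ∀ (S : Finset I) (i : I) (z : I → X), i ∉ S → w z ≠ 0 →
      α₁ ≤ cylMass w (insert i S) z / cylMass w S z)
    (hK : ∀ i, IsSiteKernel w i (Q i)) (hJ0 : ∀ i, J i i = 0)
    (hJ : ∀ i j x a, dTV (Q i (Function.update x j a)) (Q i x) ≤ J i j)
    (hJnn : ∀ i j, 0 ≤ J i j) (hJα : norm22 J ≤ 1 - α₂) (hz : ∀ i, ZerosStable w f i)
    (S : Finset I) :
    ∑ i ∈ Sᶜ, (partialEnt w f (insert i S) - partialEnt w f S) ≤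
      α₁⁻¹ * (α₂ ^ 2)⁻¹ * ∑ i ∈ Sᶜ, entProd w i (Q i) f := by
  set φ : ℝ → ℝ := fun u => u * Real.log u with hφ
  have h1 : ∀ i, partialEnt w f (insert i S) - partialEnt w f S = ∑ x, w x * ∑ z, pin w S x z *
      (φ (condExpect w f (insert i S) z) - φ (condExpect w f S x)) := by
    intro i
    rw [partialEnt, ← sum_mul_sum_pin hw S, partialEnt, ← Finset.sum_sub_distrib]
    refine Finset.sum_congr rfl fun x _ => ?_
    rcases eq_or_ne (w x) 0 with h | h
    · simp [h]
    simp only [mul_sub, Finset.sum_sub_distrib, ← Finset.sum_mul, sum_pin hw S h, one_mul, hφ]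
  simp only [h1]
  rw [Finset.sum_comm]
  simp only [← sum_mul_entProd_pin (f := f) hw S]
  rw [Finset.sum_comm (s := Sᶜ), Finset.mul_sum]
  refine Finset.sum_le_sum fun x _ => ?_
  rw [← Finset.mul_sum, ← Finset.mul_sum, mul_left_comm]
  rcases eq_or_ne (w x) 0 with h | h
  · simp [h]
  exact mul_le_mul_of_nonneg_left
    (sum_pin_entropy_le hw hf hα₁ hα₂ hβ hK hJ0 hJ hJnn hJα hz S h) (hw x)

/-- Averaging the chain rule for the entropy over the first site to be revealed turns the one-site
bound into a bound on the whole entropy, by induction over the number of unrevealed sites. -/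
lemma partialEnt_univ_sub_le (hw : ∀ x, 0 ≤ w x) (hf : ∀ x, 0 ≤ f x)
    (hα₁ : 0 < α₁) (hα₂ : 0 < α₂)
    (hβ : ∀ (S : Finset I) (i : I) (z : I → X), i ∉ S → w z ≠ 0 →
      α₁ ≤ cylMass w (insert i S) z / cylMass w S z)
    (hK : ∀ i, IsSiteKernel w i (Q i)) (hJ0 : ∀ i, J i i = 0)
    (hJ : ∀ i j x a, dTV (Q i (Function.update x j a)) (Q i x) ≤ J i j)
    (hJnn : ∀ i j, 0 ≤ J i j) (hJα : norm22 J ≤ 1 - α₂) (hz : ∀ i, ZerosStable w f i)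
    (n : ℕ) : ∀ S : Finset I, (Sᶜ).card = n →
      partialEnt w f Finset.univ - partialEnt w f S ≤
        α₁⁻¹ * (α₂ ^ 2)⁻¹ * ∑ i ∈ Sᶜ, entProd w i (Q i) f := by
  induction n with
  | zero =>
    intro S hS
    rw [Finset.card_eq_zero] at hS
    have : S = Finset.univ := (Finset.compl_eq_empty_iff S).1 hS
    simp [this]
  | succ n ih =>
    intro S hS
    set C := α₁⁻¹ * (α₂ ^ 2)⁻¹ with hC
    set A := ∑ i ∈ Sᶜ, entProd w i (Q i) f with hA
    have h1 := sum_partialEnt_insert_sub_le hw hf hα₁ hα₂ hβ hK hJ0 hJ hJnn hJα hz S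
    rw [← hC, ← hA] at h1
    have h2 : ∀ i ∈ Sᶜ, partialEnt w f Finset.univ - partialEnt w f (insert i S) ≤
        C * (A - entProd w i (Q i) f) := by
      intro i hi
      have h3 := ih (insert i S) (by
        rw [Finset.compl_insert, Finset.card_erase_of_mem hi, hS, Nat.add_sub_cancel])
      rwa [Finset.compl_insert, Finset.sum_erase_eq_sub hi] at h3
    have h4 := Finset.sum_le_sum h2
    rw [← Finset.mul_sum, Finset.sum_sub_distrib, Finset.sum_sub_distrib, Finset.sum_const,
      Finset.sum_const, hS, ← hA] at h4
    rw [Finset.sum_sub_distrib, Finset.sum_const, hS] at h1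
    simp only [nsmul_eq_mul] at h1 h4
    have hn : (0 : ℝ) < (n + 1 : ℕ) := by positivity
    refine le_of_mul_le_mul_left ?_ hn
    linear_combination h1 + h4

end ApproximateTensorization

end Pinning

/-! ### Reversible chains -/

/-- `P` is a stochastic matrix that is reversible with respect to the everywhere positive
probability vector `π`. -/
structure IsReversible {Ω : Type*} [Fintype Ω] (P : Matrix Ω Ω ℝ) (π : Ω → ℝ) : Prop where
  pos : ∀ x, 0 < π x
  sum_eq_one : ∑ x, π x = 1
  nonneg : ∀ x y, 0 ≤ P x y
  row_sum : ∀ x, ∑ y, P x y = 1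
  balance : ∀ x y, π x * P x y = π y * P y x

/-- The Dirichlet form `E_π (f (I - P) (log f))` with the real logarithm, where `log 0 = 0`. -/
def realDirichlet {Ω : Type*} [Fintype Ω] (P : Matrix Ω Ω ℝ) (π f : Ω → ℝ) : ℝ :=
  ∑ x, π x * (f x * (Real.log (f x) - ∑ y, P x y * Real.log (f y)))

/-! ### The Glauber dynamics in terms of resampling -/

section Glauber

open scoped Classical

variable {I X : Type*} [Fintype I] [Fintype X]

/-- The probabilities of all configurations as real numbers. -/
def weight (μ : PMF (I → X)) (x : I → X) : ℝ := (μ x).toReal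

/-- The extension by zero of a function on the support. -/
def extend (μ : PMF (I → X)) (f : Supp μ → ℝ) (x : I → X) : ℝ :=
  if h : μ x ≠ 0 then f ⟨x, h⟩ else 0

variable {μ : PMF (I → X)}

lemma weight_nonneg (μ : PMF (I → X)) (x : I → X) : 0 ≤ weight μ x := ENNReal.toReal_nonneg

lemma weight_ne_zero {x : I → X} : weight μ x ≠ 0 ↔ μ x ≠ 0 := by
  rw [weight, ENNReal.toReal_ne_zero]
  exact ⟨fun h => h.1, fun h => ⟨h, μ.apply_ne_top x⟩⟩

lemma sum_weight (μ : PMF (I → X)) : ∑ x, weight μ x = 1 := by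
  have h := μ.tsum_coe
  rw [tsum_fintype] at h
  simp only [weight]
  rw [← ENNReal.toReal_sum fun x _ => μ.apply_ne_top x, h, ENNReal.toReal_one]

lemma mass_pos (x : Supp μ) : 0 < mass μ x :=
  (weight_nonneg μ x.1).lt_of_ne' (weight_ne_zero.2 x.2)

@[simp] lemma extend_coe (f : Supp μ → ℝ) (x : Supp μ) : extend μ f x.1 = f x :=
  dif_pos x.2

lemma sum_supp {g : (I → X) → ℝ} (hg : ∀ x, μ x = 0 → g x = 0) :
    ∑ x : Supp μ, g x.1 = ∑ x, g x := by
  have h1 : ∑ x ∈ Finset.univ.filter (fun x => μ x ≠ 0), g x = ∑ x : {x // μ x ≠ 0}, g x.1 :=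
    Finset.sum_subtype _ (by simp) _
  have h2 : ∑ x ∈ Finset.univ.filter (fun x => μ x ≠ 0), g x = ∑ x, g x := by
    refine Finset.sum_subset (Finset.subset_univ _) fun x _ hx => hg x ?_
    simpa using hx
  rw [← h2, h1]
  rfl

lemma sum_mass_mul (μ : PMF (I → X)) (g : (I → X) → ℝ) :
    ∑ x : Supp μ, mass μ x * g x.1 = ∑ x, weight μ x * g x :=
  sum_supp (g := fun x => weight μ x * g x) fun x hx => by simp [weight, hx]

lemma sum_mass (μ : PMF (I → X)) : ∑ x, mass μ x = 1 := by
  simpa [sum_weight] using sum_mass_mul μ fun _ => 1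

lemma marginal_eq (μ : PMF (I → X)) (S : Finset I) (x : I → X) :
    marginal μ S x = cylMass (weight μ) S x := by
  refine Finset.sum_congr rfl fun z _ => ?_
  simp only [Finset.mem_coe, weight]

lemma condProb_self_eq (μ : PMF (I → X)) (S : Finset I) (i : I) (z : I → X) :
    condProb μ S i z (z i) = cylMass (weight μ) (insert i S) z / cylMass (weight μ) S z := by
  rw [condProb, marginal_eq]
  congr 1
  refine Finset.sum_congr rfl fun y _ => ?_
  simp only [Finset.mem_coe, weight]
  refine if_congr ?_ rfl rfl
  rw [Finset.forall_mem_insert, and_comm]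

lemma le_cylMass_div {α : ℝ} (h : α ≤ betaTilde μ) (S : Finset I) (i : I) (z : I → X)
    (hi : i ∉ S) (hz : weight μ z ≠ 0) :
    α ≤ cylMass (weight μ) (insert i S) z / cylMass (weight μ) S z := by
  rw [← condProb_self_eq]
  have hS : (S : Set I) ≠ Set.univ := fun hS => hi (by
    rw [← Finset.mem_coe, hS]
    trivial)
  have hi' : i ∉ (S : Set I) := by simpa using hi
  have h1 : betaTilde μ ≤ ⨅ i : {i : I // i ∉ (S : Set I)}, betaTildeAt μ S i.1 :=
    ciInf_le (Set.finite_range _).bddBelow (⟨S, hS⟩ : {S : Set I // S ≠ Set.univ})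
  have h2 : (⨅ i : {i : I // i ∉ (S : Set I)}, betaTildeAt μ S i.1) ≤ betaTildeAt μ S i :=
    ciInf_le (Set.finite_range fun i : {i : I // i ∉ (S : Set I)} =>
      betaTildeAt μ S i.1).bddBelow ⟨i, hi'⟩
  have h3 : betaTildeAt μ S i ≤ condProb μ S i z (z i) :=
    ciInf_le (Set.finite_range fun z : Supp μ => condProb μ S i z.1 (z.1 i)).bddBelow
      (⟨z, weight_ne_zero.1 hz⟩ : Supp μ)
  exact h.trans (h1.trans (h2.trans h3))

lemma eq_update_iff {i : I} {x y : I → X} :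
    (∀ j, j ≠ i → x j = y j) ↔ Function.update x i (y i) = y := by
  rw [funext_iff]
  refine forall_congr' fun j => ?_
  rcases eq_or_ne j i with rfl | h
  · simp
  · simp [h]

/-- The configurations that agree with `x` off `i` are the updates of `x` at `i`. -/
lemma sum_ite_agree (i : I) (x : I → X) (g : (I → X) → ℝ) :
    ∑ y, (if ∀ j, j ≠ i → x j = y j then g y else 0) = ∑ a, g (Function.update x i a) := by
  rw [← Finset.sum_filter]
  symm
  refine Finset.sum_bij (fun a _ => Function.update x i a) (fun a _ => ?_)
    (fun a _ b _ h => Function.update_injective x i h) (fun y hy => ?_) (fun a _ => rfl)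
  · rw [Finset.mem_filter]
    exact ⟨Finset.mem_univ _, fun j hj => by simp [hj]⟩
  · rw [Finset.mem_filter] at hy
    exact ⟨y i, Finset.mem_univ _, eq_update_iff.1 hy.2⟩

lemma marginal_compl_singleton (μ : PMF (I → X)) (i : I) (x : I → X) :
    marginal μ {i}ᶜ x = ∑ a, weight μ (Function.update x i a) := by
  rw [← sum_ite_agree, marginal]
  refine Finset.sum_congr rfl fun z _ => ?_
  have h : (∀ j ∈ ({i}ᶜ : Set I), z j = x j) ↔ ∀ j, j ≠ i → x j = z j :=
    forall₂_congr fun j _ => eq_comm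
  simp only [h]
  rfl

lemma condProb_compl_singleton (μ : PMF (I → X)) (i : I) (x : I → X) (a : X) :
    condProb μ {i}ᶜ i x a =
      weight μ (Function.update x i a) / ∑ b, weight μ (Function.update x i b) := by
  rw [condProb, marginal_compl_singleton]
  congr 1
  rw [Finset.sum_eq_single (Function.update x i a)]
  · rw [if_pos ⟨fun j hj => by
      rw [Function.update_of_ne (by simpa using hj)], Function.update_self _ _ _⟩]
    rfl
  · intro z _ hz
    refine if_neg fun h => hz ?_
    obtain ⟨h1, rfl⟩ := h
    exact (eq_update_iff.1 fun j hj => (h1 j (by simpa using hj)).symm).symm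
  · simp

lemma IsCondVersion.isSiteKernel {Q : I → (I → X) → X → ℝ} (hQ : IsCondVersion μ Q) (i : I) :
    IsSiteKernel (weight μ) i (Q i) where
  nonneg x a := (hQ.1 i x).1 a
  sum_eq_one x := (hQ.1 i x).2
  update_eq x a := hQ.2.1 i _ _ fun j hj => by simp [hj]
  balance x a := by
    have h0 : 0 ≤ ∑ b, weight μ (Function.update x i b) :=
      Finset.sum_nonneg fun b _ => weight_nonneg μ _
    rcases h0.eq_or_lt with h | h
    · rw [← h, mul_zero]
      exact (Finset.sum_eq_zero_iff_of_nonneg fun b _ => weight_nonneg μ _).1 h.symm a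
        (Finset.mem_univ a)
    · rw [hQ.2.2 i x (by rwa [marginal_compl_singleton]), condProb_compl_singleton,
        div_mul_cancel₀ _ h.ne']

lemma sum_weight_update_pos (i : I) {x : I → X} (hx : μ x ≠ 0) :
    0 < ∑ b, weight μ (Function.update x i b) := by
  refine Finset.sum_pos' (fun b _ => weight_nonneg μ _) ⟨x i, Finset.mem_univ _, ?_⟩
  rw [Function.update_eq_self]
  exact mass_pos ⟨x, hx⟩

lemma condProb_nonneg (μ : PMF (I → X)) (i : I) (x : I → X) (a : X) :
    0 ≤ condProb μ {i}ᶜ i x a := by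
  rw [condProb_compl_singleton]
  exact div_nonneg (weight_nonneg μ _) (Finset.sum_nonneg fun b _ => weight_nonneg μ _)

lemma glauber_nonneg (x y : Supp μ) : 0 ≤ glauber μ x y := by
  refine mul_nonneg (by positivity) (Finset.sum_nonneg fun i _ => ?_)
  refine mul_nonneg (condProb_nonneg μ i _ _) ?_
  split_ifs <;> norm_num

/-- The Glauber dynamics resamples the spin at a uniformly chosen site. -/
lemma sum_glauber_mul {Q : I → (I → X) → X → ℝ} (hQ : IsCondVersion μ Q) (x : Supp μ)
    (g : (I → X) → ℝ) :
    ∑ y : Supp μ, glauber μ x y * g y.1 =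
      (Fintype.card I : ℝ)⁻¹ * ∑ i, resample i (Q i) g x.1 := by
  have h1 := sum_supp (μ := μ) (g := fun y => ((Fintype.card I : ℝ)⁻¹ *
    ∑ i, condProb μ {i}ᶜ i x.1 (y i) * (if ∀ j, j ≠ i → x.1 j = y j then 1 else 0)) * g y) (by
      intro y hy
      have : ∀ i, condProb μ {i}ᶜ i x.1 (y i) *
          (if ∀ j, j ≠ i → x.1 j = y j then (1 : ℝ) else 0) = 0 := by
        intro i
        split_ifs with h
        · rw [condProb_compl_singleton, eq_update_iff.1 h]
          simp [weight, hy]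
        · simp
      simp [this])
  refine h1.trans ?_
  simp only [mul_assoc]
  rw [← Finset.mul_sum]
  congr 1
  simp only [Finset.sum_mul]
  rw [Finset.sum_comm]
  refine Finset.sum_congr rfl fun i _ => ?_
  have h2 : ∀ y : I → X, condProb μ {i}ᶜ i x.1 (y i) *
      (if ∀ j, j ≠ i → x.1 j = y j then (1 : ℝ) else 0) * g y =
      if ∀ j, j ≠ i → x.1 j = y j then condProb μ {i}ᶜ i x.1 (y i) * g y else 0 := by
    intro y
    split_ifs <;> simp
  rw [Finset.sum_congr rfl fun y _ => h2 y, sum_ite_agree, resample]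
  refine Finset.sum_congr rfl fun a _ => ?_
  rw [Function.update_self, hQ.2.2 i x.1]
  rw [marginal_compl_singleton]
  exact sum_weight_update_pos i x.2

lemma glauber_balance (x y : Supp μ) :
    mass μ x * glauber μ x y = mass μ y * glauber μ y x := by
  simp only [glauber]
  rw [mul_left_comm, mul_left_comm (mass μ y)]
  congr 1
  rw [Finset.mul_sum, Finset.mul_sum]
  refine Finset.sum_congr rfl fun i _ => ?_
  by_cases h : ∀ j, j ≠ i → x.1 j = y.1 j
  · have h' : ∀ j, j ≠ i → y.1 j = x.1 j := fun j hj => (h j hj).symm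
    have hxy := eq_update_iff.1 h
    have hyx := eq_update_iff.1 h'
    have hsum : ∑ b, weight μ (Function.update y.1 i b) =
        ∑ b, weight μ (Function.update x.1 i b) := by
      rw [← hxy]
      simp
    rw [if_pos h, if_pos h', condProb_compl_singleton, condProb_compl_singleton, hsum, hxy, hyx]
    change weight μ x.1 * _ = weight μ y.1 * _
    ring
  · have h' : ¬ ∀ j, j ≠ i → y.1 j = x.1 j := fun h2 => h fun j hj => (h2 j hj).symm
    rw [if_neg h, if_neg h']
    simp

lemma glauber_isReversible [Nonempty I] {Q : I → (I → X) → X → ℝ} (hQ : IsCondVersion μ Q) :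
    IsReversible (glauber μ) (mass μ) where
  pos := mass_pos
  sum_eq_one := sum_mass μ
  nonneg := glauber_nonneg
  row_sum x := by
    have h := sum_glauber_mul hQ x fun _ => 1
    simp only [mul_one] at h
    rw [h]
    have h1 : ∀ i, resample i (Q i) (fun _ => (1 : ℝ)) x.1 = 1 :=
      fun i => resample_eq_self (hQ.isSiteKernel i) (fun _ _ => rfl) _
    simp [h1]
  balance := glauber_balance

lemma glauber_ne_zero [Nonempty I] {i : I} {x y : Supp μ} (h : ∀ j, j ≠ i → x.1 j = y.1 j) :
    glauber μ x y ≠ 0 := by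
  refine (mul_pos (by positivity) ?_).ne'
  refine Finset.sum_pos' (fun j _ => ?_) ⟨i, Finset.mem_univ _, ?_⟩
  · refine mul_nonneg (condProb_nonneg μ j _ _) ?_
    split_ifs <;> norm_num
  · rw [if_pos h, mul_one, condProb_compl_singleton, eq_update_iff.1 h]
    exact div_pos (mass_pos y) (sum_weight_update_pos i x.2)

lemma ent_mass (f : Supp μ → ℝ) :
    Ent (mass μ) f = partialEnt (weight μ) (extend μ f) Finset.univ -
      partialEnt (weight μ) (extend μ f) ∅ := by
  have h1 := sum_mass_mul μ fun x => extend μ f x * Real.log (extend μ f x)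
  have h2 := sum_mass_mul μ (extend μ f)
  simp only [extend_coe] at h1 h2
  rw [partialEnt_univ, partialEnt_empty (sum_weight μ), Ent, h1, h2]

lemma realDirichlet_glauber {Q : I → (I → X) → X → ℝ} (hQ : IsCondVersion μ Q) [Nonempty I]
    (f : Supp μ → ℝ) :
    realDirichlet (glauber μ) (mass μ) f =
      (Fintype.card I : ℝ)⁻¹ * ∑ i, entProd (weight μ) i (Q i) (extend μ f) := by
  have h1 : ∀ x : Supp μ, ∑ y, glauber μ x y * Real.log (f y) =
      (Fintype.card I : ℝ)⁻¹ *
        ∑ i, resample i (Q i) (fun z => Real.log (extend μ f z)) x.1 := by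
    intro x
    rw [← sum_glauber_mul hQ]
    simp only [extend_coe]
  have h2 := sum_mass_mul μ fun x => extend μ f x * (Real.log (extend μ f x) -
    (Fintype.card I : ℝ)⁻¹ * ∑ i, resample i (Q i) (fun z => Real.log (extend μ f z)) x)
  simp only [extend_coe] at h2
  rw [realDirichlet]
  simp only [h1]
  rw [h2]
  simp only [entProd]
  rw [Finset.sum_comm, Finset.mul_sum]
  refine Finset.sum_congr rfl fun x _ => ?_
  have hn : (Fintype.card I : ℝ) ≠ 0 := by simp
  rw [← Finset.mul_sum, ← Finset.mul_sum, Finset.sum_sub_distrib, Finset.sum_const,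
    Finset.card_univ, nsmul_eq_mul]
  field_simp

/-- The modified logarithmic Sobolev inequality, for functions whose zeros do not communicate with
the points where they are positive. -/
lemma ent_le_realDirichlet [Nonempty I] {α₁ α₂ : ℝ} (hα₁ : 0 < α₁) (hα₂ : 0 < α₂)
    (hμ : WeaklyDependent μ α₁ α₂) {f : Supp μ → ℝ} (hf : ∀ x, 0 ≤ f x)
    (hz : ∀ x y, glauber μ x y ≠ 0 → f y = 0 → f x = 0) :
    Ent (mass μ) f ≤
      (Fintype.card I : ℝ) * α₁⁻¹ * (α₂ ^ 2)⁻¹ * realDirichlet (glauber μ) (mass μ) f := by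
  obtain ⟨hβ, J, ⟨hJ0, Q, hQ, hJ⟩, hJα⟩ := hμ
  have hJnn : ∀ i j, 0 ≤ J i j := by
    intro i j
    obtain ⟨x, _⟩ := μ.support_nonempty
    have := hJ i j x x fun _ _ => rfl
    simpa [dTV] using this
  have hf' : ∀ x, 0 ≤ extend μ f x := by
    intro x
    unfold extend
    split_ifs
    exacts [hf _, le_rfl]
  have hz' : ∀ i, ZerosStable (weight μ) (extend μ f) i := by
    intro i x a hx hxa h
    rw [weight_ne_zero] at hx hxa
    let x' : Supp μ := ⟨x, hx⟩
    let y' : Supp μ := ⟨Function.update x i a, hxa⟩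
    have h1 : f x' = 0 := (extend_coe f x').symm.trans h
    exact (extend_coe f y').trans
      (hz y' x' (glauber_ne_zero (i := i) fun j hj => by simp [x', y', hj]) h1)
  have hmain := partialEnt_univ_sub_le (weight_nonneg μ) hf' hα₁ hα₂ (le_cylMass_div hβ)
    hQ.isSiteKernel hJ0 (fun i j x a => hJ i j _ _ fun k hk => by simp [hk]) hJnn hJα hz' _ ∅ rfl
  rw [← ent_mass, Finset.compl_empty] at hmain
  refine hmain.trans (le_of_eq ?_)
  rw [realDirichlet_glauber hQ]
  have hn : (Fintype.card I : ℝ) ≠ 0 := by simp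
  field_simp

end Glauber

/-! ### The Dirichlet form with values in the extended reals -/

section ExtendedReal

variable {Ω : Type*} [Fintype Ω] {P : Matrix Ω Ω ℝ} {π f : Ω → ℝ}

lemma extLog_of_pos {r : ℝ} (hr : 0 < r) : extLog r = (Real.log r : ℝ) := by
  rw [extLog, ENNReal.log_ofReal_of_pos hr]

lemma extLog_zero : extLog 0 = ⊥ := by simp [extLog]

lemma ereal_coe_sum {ι : Type*} (s : Finset ι) (u : ι → ℝ) :
    ((∑ i ∈ s, u i : ℝ) : EReal) = ∑ i ∈ s, (u i : EReal) := by
  classical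
  induction s using Finset.induction_on with
  | empty => simp
  | insert i s hi ih => rw [Finset.sum_insert hi, Finset.sum_insert hi, EReal.coe_add, ih]

lemma coe_mul_extLog_eq {p r : ℝ} (hr : 0 ≤ r) (h : p ≠ 0 → r ≠ 0) :
    (p : EReal) * extLog r = ((p * Real.log r : ℝ) : EReal) := by
  rcases eq_or_ne p 0 with rfl | hp
  · simp
  · rw [extLog_of_pos (hr.lt_of_ne' (h hp)), EReal.coe_mul]

lemma dirichletForm_eq_coe (hf : ∀ x, 0 ≤ f x) (hz : ∀ x y, P x y ≠ 0 → f y = 0 → f x = 0) :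
    dirichletForm P π f (fun x => extLog (f x)) = (realDirichlet P π f : ℝ) := by
  rw [dirichletForm, realDirichlet, ereal_coe_sum]
  refine Finset.sum_congr rfl fun x _ => ?_
  rcases eq_or_ne (f x) 0 with h | h
  · simp [h]
  have h1 : ∑ y, (P x y : EReal) * extLog (f y) = ((∑ y, P x y * Real.log (f y) : ℝ) : EReal) := by
    rw [ereal_coe_sum]
    exact Finset.sum_congr rfl fun y _ =>
      coe_mul_extLog_eq (hf y) fun hP hy => h (hz x y hP hy)
  rw [h1, extLog_of_pos ((hf x).lt_of_ne' h), ← EReal.coe_sub, ← EReal.coe_mul, mul_assoc]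

lemma ereal_sum_ne_top {ι : Type*} {s : Finset ι} {u : ι → EReal} (h : ∀ i ∈ s, u i ≠ ⊤) :
    ∑ i ∈ s, u i ≠ ⊤ := by
  classical
  induction s using Finset.induction_on with
  | empty => simp
  | insert i s hi ih =>
    rw [Finset.sum_insert hi]
    exact EReal.add_ne_top (h i (by simp)) (ih fun j hj => h j (by simp [hj]))

lemma ereal_sum_ne_bot {ι : Type*} {s : Finset ι} {u : ι → EReal} (h : ∀ i ∈ s, u i ≠ ⊥) :
    ∑ i ∈ s, u i ≠ ⊥ := by
  classical
  induction s using Finset.induction_on with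
  | empty => simp
  | insert i s hi ih =>
    rw [Finset.sum_insert hi, Ne, EReal.add_eq_bot_iff, not_or]
    exact ⟨h i (by simp), ih fun j hj => h j (by simp [hj])⟩

lemma ereal_sum_eq_bot {ι : Type*} {s : Finset ι} {u : ι → EReal} {i : ι} (hi : i ∈ s)
    (h : u i = ⊥) : ∑ i ∈ s, u i = ⊥ := by
  classical
  rw [← Finset.add_sum_erase s u hi, h, EReal.bot_add]

lemma ereal_sum_eq_top {ι : Type*} {s : Finset ι} {u : ι → EReal} {i : ι} (hi : i ∈ s)
    (h : u i = ⊤) (hne : ∀ j ∈ s, u j ≠ ⊥) : ∑ i ∈ s, u i = ⊤ := by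
  classical
  rw [← Finset.add_sum_erase s u hi, h]
  exact EReal.top_add_of_ne_bot
    (ereal_sum_ne_bot fun j hj => hne j (Finset.mem_of_mem_erase hj))

lemma extLog_ne_top (r : ℝ) : extLog r ≠ ⊤ := by
  rw [extLog, Ne, ENNReal.log_eq_top_iff]
  exact ENNReal.ofReal_ne_top

lemma coe_mul_extLog_ne_top {p : ℝ} (hp : 0 ≤ p) (r : ℝ) : (p : EReal) * extLog r ≠ ⊤ := by
  rcases hp.eq_or_lt with rfl | hp
  · simp
  rcases eq_or_ne (extLog r) ⊥ with h | h
  · rw [h, EReal.coe_mul_bot_of_pos hp]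
    simp
  · lift extLog r to ℝ using ⟨extLog_ne_top r, h⟩ with t
    rw [← EReal.coe_mul]
    exact EReal.coe_ne_top _

lemma dirichletForm_eq_top (hπ : ∀ x, 0 < π x) (hP : ∀ x y, 0 ≤ P x y) (hf : ∀ x, 0 ≤ f x)
    {x y : Ω} (hxy : P x y ≠ 0) (hy : f y = 0) (hx : f x ≠ 0) :
    dirichletForm P π f (fun x => extLog (f x)) = ⊤ := by
  have hbot : ∀ z, f z ≠ 0 →
      extLog (f z) - ∑ y, (P z y : EReal) * extLog (f y) ≠ ⊥ := by
    intro z hz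
    rw [extLog_of_pos ((hf z).lt_of_ne' hz), sub_eq_add_neg, Ne, EReal.add_eq_bot_iff, not_or]
    refine ⟨EReal.coe_ne_bot _, fun h => ?_⟩
    rw [EReal.neg_eq_bot_iff] at h
    exact ereal_sum_ne_top (fun y _ => coe_mul_extLog_ne_top (hP z y) _) h
  refine ereal_sum_eq_top (Finset.mem_univ x) ?_ fun z _ => ?_
  · have h1 : ∑ y, (P x y : EReal) * extLog (f y) = ⊥ := by
      refine ereal_sum_eq_bot (Finset.mem_univ y) ?_
      rw [hy, extLog_zero, EReal.coe_mul_bot_of_pos ((hP x y).lt_of_ne' hxy)]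
    dsimp only
    rw [h1, extLog_of_pos ((hf x).lt_of_ne' hx), EReal.coe_sub_bot,
      EReal.coe_mul_top_of_pos (mul_pos (hπ x) ((hf x).lt_of_ne' hx))]
  · rcases eq_or_ne (f z) 0 with hz | hz
    · simp [hz]
    have hpos : 0 < π z * f z := mul_pos (hπ z) ((hf z).lt_of_ne' hz)
    have h2 := hbot z hz
    generalize extLog (f z) - ∑ y, (P z y : EReal) * extLog (f y) = e at h2
    induction e with
    | bot => exact absurd rfl h2
    | coe r => rw [← EReal.coe_mul]; exact EReal.coe_ne_bot _
    | top => rw [EReal.coe_mul_top_of_pos hpos]; simp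

/-- To prove a modified logarithmic Sobolev inequality, one may assume that the zeros of `f` do not
communicate with the points where `f` is positive: otherwise the right-hand side is infinite. -/
lemma mlsi_of_realDirichlet (hπ : ∀ x, 0 < π x) (hP : ∀ x y, 0 ≤ P x y) {ρ : ℝ} (hρ : 0 < ρ)
    (h : ∀ f : Ω → ℝ, (∀ x, 0 ≤ f x) → (∀ x y, P x y ≠ 0 → f y = 0 → f x = 0) →
      Ent π f ≤ ρ / 2 * realDirichlet P π f) : MLSI P π ρ := by
  intro f hf
  by_cases hz : ∀ x y, P x y ≠ 0 → f y = 0 → f x = 0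
  · rw [dirichletForm_eq_coe hf hz, ← EReal.coe_mul, EReal.coe_le_coe_iff]
    exact h f hf hz
  · push Not at hz
    obtain ⟨x, y, hxy, hy, hx⟩ := hz
    rw [dirichletForm_eq_top hπ hP hf hxy hy hx, EReal.coe_mul_top_of_pos (by positivity)]
    exact le_top

end ExtendedReal

/-! ### The semigroup of a reversible chain -/

section Semigroup

open scoped Classical

variable {Ω : Type*} [Fintype Ω] {P : Matrix Ω Ω ℝ} {π : Ω → ℝ}

lemma exp_entry_nonneg {A : Matrix Ω Ω ℝ} (hA : ∀ x y, 0 ≤ A x y) (x y : Ω) :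
    0 ≤ NormedSpace.exp A x y := by
  have hpow : ∀ (n : ℕ) x y, 0 ≤ (A ^ n) x y := by
    intro n
    induction n with
    | zero =>
      intro x y
      rw [pow_zero, Matrix.one_apply]
      split_ifs <;> norm_num
    | succ n ih =>
      intro x y
      rw [pow_succ, Matrix.mul_apply]
      exact Finset.sum_nonneg fun z _ => mul_nonneg (ih x z) (hA z y)
  rw [congrFun NormedSpace.exp_eq_tsum_rat A]
  by_cases hs : Summable fun n : ℕ => ((n.factorial : ℚ)⁻¹) • A ^ n
  · have h := (Pi.hasSum.1 (Pi.hasSum.1 hs.hasSum x)) y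
    refine h.nonneg fun n => ?_
    change 0 ≤ ((n.factorial : ℚ)⁻¹) • (A ^ n) x y
    rw [Rat.smul_def]
    exact mul_nonneg (by positivity) (hpow n x y)
  · rw [tsum_eq_zero_of_not_summable hs]
    exact le_rfl

lemma semigroup_nonneg (hP : ∀ x y, 0 ≤ P x y) {t : ℝ} (ht : 0 ≤ t) (x y : Ω) :
    0 ≤ semigroup P t x y := by
  have h1 : t • (P - 1) = t • P + Matrix.diagonal fun _ => -t := by
    rw [smul_sub, sub_eq_add_neg, ← neg_smul, ← Matrix.diagonal_one, ← Matrix.diagonal_smul]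
    congr 2
    ext
    simp
  have h2 : Commute (t • P) (Matrix.diagonal fun _ => -t) := by
    have : (Matrix.diagonal fun _ : Ω => -t) = (-t) • (1 : Matrix Ω Ω ℝ) := by
      rw [← Matrix.diagonal_one, ← Matrix.diagonal_smul]
      congr 1
      ext
      simp
    rw [this]
    exact (Commute.one_right _).smul_right _
  rw [semigroup, h1, Matrix.exp_add_of_commute _ _ h2, Matrix.exp_diagonal, Matrix.mul_diagonal,
    Pi.coe_exp, ← Real.exp_eq_exp_ℝ]
  exact mul_nonneg (exp_entry_nonneg (fun x y => mul_nonneg ht (hP x y)) x y) (Real.exp_nonneg _)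

lemma hasDerivAt_semigroup (P : Matrix Ω Ω ℝ) (t : ℝ) (x y : Ω) :
    HasDerivAt (fun s => semigroup P s x y) (((P - 1) * semigroup P t) x y) t := by
  let _ : NormedRing (Matrix Ω Ω ℝ) := Matrix.linftyOpNormedRing
  let _ : NormedAlgebra ℝ (Matrix Ω Ω ℝ) := Matrix.linftyOpNormedAlgebra
  have h := hasDerivAt_exp_smul_const' (𝕂 := ℝ) (P - 1) t
  let L : Matrix Ω Ω ℝ →ₗ[ℝ] ℝ :=
    { toFun := fun M => M x y
      map_add' := fun _ _ => rfl
      map_smul' := fun _ _ => rfl }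
  exact (LinearMap.toContinuousLinearMap L).hasFDerivAt.comp_hasDerivAt t h

lemma hasDerivAt_semigroup_mulVec (P : Matrix Ω Ω ℝ) (f : Ω → ℝ) (t : ℝ) (x : Ω) :
    HasDerivAt (fun s => (semigroup P s).mulVec f x)
      ((P - 1).mulVec ((semigroup P t).mulVec f) x) t := by
  have h := HasDerivAt.fun_sum (u := Finset.univ) fun y _ =>
    (hasDerivAt_semigroup P t x y).mul_const (f y)
  rw [Matrix.mulVec_mulVec]
  exact h

lemma semigroup_zero (P : Matrix Ω Ω ℝ) : semigroup P 0 = 1 := by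
  rw [semigroup, zero_smul, NormedSpace.exp_zero]

lemma sub_one_mulVec_apply (P : Matrix Ω Ω ℝ) (f : Ω → ℝ) (x : Ω) :
    (P - 1).mulVec f x = ∑ y, P x y * f y - f x := by
  rw [Matrix.sub_mulVec, Matrix.one_mulVec, Pi.sub_apply]
  rfl

lemma sum_mul_sum_mul_comm (hP : IsReversible P π) (f g : Ω → ℝ) :
    ∑ x, π x * (f x * ∑ y, P x y * g y) = ∑ x, π x * ((∑ y, P x y * f y) * g x) := by
  simp only [Finset.mul_sum, Finset.sum_mul]
  rw [Finset.sum_comm]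
  refine Finset.sum_congr rfl fun x _ => Finset.sum_congr rfl fun y _ => ?_
  linear_combination f y * g x * hP.balance y x

lemma sum_mul_generator (hP : IsReversible P π) (f : Ω → ℝ) :
    ∑ x, π x * (P - 1).mulVec f x = 0 := by
  have h := sum_mul_sum_mul_comm hP (fun _ => 1) f
  simp only [mul_one, one_mul, hP.row_sum] at h
  simp only [sub_one_mulVec_apply, mul_sub, Finset.sum_sub_distrib, h, sub_self]

lemma sum_generator_mul_log (hP : IsReversible P π) (f : Ω → ℝ) :
    ∑ x, π x * ((P - 1).mulVec f x * Real.log (f x)) = -realDirichlet P π f := by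
  have h := sum_mul_sum_mul_comm hP f fun y => Real.log (f y)
  rw [realDirichlet]
  simp only [sub_one_mulVec_apply, mul_sub, sub_mul, Finset.sum_sub_distrib, h]
  ring

lemma semigroup_mulVec_one (hP : IsReversible P π) (t : ℝ) :
    (semigroup P t).mulVec (fun _ => 1) = fun _ => 1 := by
  have h1 : (P - 1).mulVec (fun _ => (1 : ℝ)) = 0 := by
    ext x
    simp [sub_one_mulVec_apply, hP.row_sum]
  ext x
  have hd : ∀ s, HasDerivAt (fun s => (semigroup P s).mulVec (fun _ => 1) x) 0 s := by
    intro s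
    have h := hasDerivAt_semigroup_mulVec P (fun _ => 1) s x
    have hcomm : (P - 1) * semigroup P s = semigroup P s * (P - 1) :=
      ((Commute.refl (P - 1)).smul_right s).exp_right
    rwa [Matrix.mulVec_mulVec, hcomm, ← Matrix.mulVec_mulVec, h1, Matrix.mulVec_zero] at h
  have h := is_const_of_deriv_eq_zero (fun s => (hd s).differentiableAt) (fun s => (hd s).deriv) t 0
  rw [h, semigroup_zero, Matrix.one_mulVec]

lemma sum_mul_semigroup (hP : IsReversible P π) (f : Ω → ℝ) (t : ℝ) :
    ∑ x, π x * (semigroup P t).mulVec f x = ∑ x, π x * f x := by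
  have hd : ∀ s, HasDerivAt (fun s => ∑ x, π x * (semigroup P s).mulVec f x) 0 s := by
    intro s
    have h := HasDerivAt.fun_sum (u := Finset.univ) fun x _ =>
      (hasDerivAt_semigroup_mulVec P f s x).const_mul (π x)
    rwa [sum_mul_generator hP] at h
  have h := is_const_of_deriv_eq_zero (fun s => (hd s).differentiableAt) (fun s => (hd s).deriv) t 0
  rw [h, semigroup_zero, Matrix.one_mulVec]

lemma semigroup_mulVec_nonneg (hP : IsReversible P π) {f : Ω → ℝ} (hf : ∀ x, 0 ≤ f x) {t : ℝ}
    (ht : 0 ≤ t) (x : Ω) : 0 ≤ (semigroup P t).mulVec f x :=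
  Finset.sum_nonneg fun y _ => mul_nonneg (semigroup_nonneg hP.nonneg ht x y) (hf y)

lemma semigroup_mulVec_pos (hP : IsReversible P π) {f : Ω → ℝ} (hf : ∀ x, 0 < f x) {t : ℝ}
    (ht : 0 ≤ t) (x : Ω) : 0 < (semigroup P t).mulVec f x := by
  obtain ⟨z, _, hz⟩ := Finset.exists_min_image Finset.univ f ⟨x, Finset.mem_univ x⟩
  have h1 := congrFun (semigroup_mulVec_one hP t) x
  have h2 : f z * 1 ≤ (semigroup P t).mulVec f x := by
    rw [← h1, Matrix.mulVec, Matrix.mulVec, dotProduct, dotProduct, Finset.mul_sum]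
    refine Finset.sum_le_sum fun y hy => ?_
    rw [mul_one, mul_comm]
    exact mul_le_mul_of_nonneg_left (hz y hy) (semigroup_nonneg hP.nonneg ht x y)
  linarith [hf z]

lemma isDensity_semigroup (hP : IsReversible P π) {f : Ω → ℝ} (hf : IsDensity π f) {t : ℝ}
    (ht : 0 ≤ t) : IsDensity π ((semigroup P t).mulVec f) :=
  ⟨semigroup_mulVec_nonneg hP hf.1 ht, by rw [sum_mul_semigroup hP, hf.2]⟩

lemma ent_of_isDensity {f : Ω → ℝ} (hf : IsDensity π f) :
    Ent π f = ∑ x, π x * (f x * Real.log (f x)) := by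
  rw [Ent, hf.2, Real.log_one, mul_zero, sub_zero]

lemma sub_one_le_mul_log {u : ℝ} (hu : 0 ≤ u) : u - 1 ≤ u * Real.log u := by
  rcases hu.eq_or_lt with rfl | hu
  · simp
  · have h := mul_le_mul_of_nonneg_left (Real.one_sub_inv_le_log_of_pos hu) hu.le
    rwa [mul_sub, mul_one, mul_inv_cancel₀ hu.ne'] at h

lemma ent_nonneg (hP : IsReversible P π) {f : Ω → ℝ} (hf : IsDensity π f) : 0 ≤ Ent π f := by
  rw [ent_of_isDensity hf]
  have h : ∑ x, π x * (f x - 1) = 0 := by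
    simp only [mul_sub, mul_one, Finset.sum_sub_distrib, hf.2, hP.sum_eq_one, sub_self]
  rw [← h]
  exact Finset.sum_le_sum fun x _ =>
    mul_le_mul_of_nonneg_left (sub_one_le_mul_log (hf.1 x)) (hP.pos x).le

/-- The entropy is dissipated at the rate of the Dirichlet form. -/
lemma hasDerivAt_ent (hP : IsReversible P π) {f : Ω → ℝ} (hf : ∀ x, 0 < f x) {t : ℝ} (ht : 0 ≤ t) :
    HasDerivAt (fun s => Ent π ((semigroup P s).mulVec f))
      (-realDirichlet P π ((semigroup P t).mulVec f)) t := by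
  set u := (semigroup P t).mulVec f with hu
  have h1 : ∀ x, HasDerivAt (fun s => (semigroup P s).mulVec f x *
      Real.log ((semigroup P s).mulVec f x))
      ((Real.log (u x) + 1) * (P - 1).mulVec u x) t := fun x =>
    HasDerivAt.comp (h₂ := fun v => v * Real.log v) t
      (Real.hasDerivAt_mul_log (semigroup_mulVec_pos hP hf ht x).ne')
      (hasDerivAt_semigroup_mulVec P f t x)
  have h2 := (HasDerivAt.fun_sum (u := Finset.univ) fun x _ =>
    (h1 x).const_mul (π x)).sub_const ((∑ x, π x * f x) * Real.log (∑ x, π x * f x))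
  have h3 : ∑ x, π x * ((Real.log (u x) + 1) * (P - 1).mulVec u x) = -realDirichlet P π u := by
    rw [← sum_generator_mul_log hP, ← add_zero (∑ x, π x * ((P - 1).mulVec u x * Real.log (u x))),
      ← sum_mul_generator hP u, ← Finset.sum_add_distrib]
    exact Finset.sum_congr rfl fun x _ => by ring
  rw [h3] at h2
  simpa only [Ent, sum_mul_semigroup hP] using h2

/-- Exponential decay of the entropy of positive densities, from a logarithmic Sobolev inequality
restricted to positive functions. -/
lemma ent_semigroup_le_of_pos (hP : IsReversible P π) {c : ℝ}
    (hc : ∀ f : Ω → ℝ, IsDensity π f → (∀ x, 0 < f x) → c * Ent π f ≤ realDirichlet P π f)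
    {f : Ω → ℝ} (hf : IsDensity π f) (hpos : ∀ x, 0 < f x) {t : ℝ} (ht : 0 ≤ t) :
    Ent π ((semigroup P t).mulVec f) ≤ Ent π f * Real.exp (-c * t) := by
  have hd : ∀ s, 0 ≤ s → HasDerivAt
      (fun s => Ent π ((semigroup P s).mulVec f) * Real.exp (c * s))
      (-realDirichlet P π ((semigroup P s).mulVec f) * Real.exp (c * s) +
        Ent π ((semigroup P s).mulVec f) * (Real.exp (c * s) * c)) s := by
    intro s hs
    refine (hasDerivAt_ent hP hpos hs).mul ?_
    simpa using ((hasDerivAt_id s).const_mul c).exp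
  have hanti : AntitoneOn (fun s => Ent π ((semigroup P s).mulVec f) * Real.exp (c * s))
      (Set.Ici 0) := by
    refine antitoneOn_of_deriv_nonpos (convex_Ici 0)
      (fun s hs => (hd s hs).continuousAt.continuousWithinAt)
      (fun s hs => (hd s (interior_subset hs)).differentiableAt.differentiableWithinAt)
      fun s hs => ?_
    have hs' : 0 ≤ s := interior_subset (s := Set.Ici (0 : ℝ)) hs
    rw [(hd s hs').deriv]
    have h1 := hc _ (isDensity_semigroup hP hf hs') (semigroup_mulVec_pos hP hpos hs')
    nlinarith [Real.exp_pos (c * s)]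
  have h := hanti (Set.self_mem_Ici) (show t ∈ Set.Ici (0 : ℝ) from ht) ht
  simp only [semigroup_zero, Matrix.one_mulVec, mul_zero, Real.exp_zero, mul_one] at h
  rw [neg_mul, Real.exp_neg, ← div_eq_mul_inv]
  exact (le_div_iff₀ (Real.exp_pos _)).2 h

lemma continuous_ent (π : Ω → ℝ) : Continuous (Ent π) := by
  unfold Ent
  have h : Continuous fun u : ℝ => u * Real.log u := Real.continuous_mul_log
  refine Continuous.sub (continuous_finsetSum _ fun x _ => ?_) ?_
  · exact continuous_const.mul (h.comp (continuous_apply x))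
  · exact h.comp (continuous_finsetSum _ fun x _ => continuous_const.mul (continuous_apply x))

/-- Exponential decay of the entropy of densities, by approximation with positive densities. -/
lemma ent_semigroup_le (hP : IsReversible P π) {c : ℝ}
    (hc : ∀ f : Ω → ℝ, IsDensity π f → (∀ x, 0 < f x) → c * Ent π f ≤ realDirichlet P π f)
    {f : Ω → ℝ} (hf : IsDensity π f) {t : ℝ} (ht : 0 ≤ t) :
    Ent π ((semigroup P t).mulVec f) ≤ Ent π f * Real.exp (-c * t) := by
  let F : ℝ → Ω → ℝ := fun ε x => (1 - ε) * f x + ε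
  have hF : Continuous F := by fun_prop
  have hF0 : F 0 = f := by
    ext x
    simp [F]
  have hdens : ∀ ε ∈ Set.Ioo (0 : ℝ) 1, IsDensity π (F ε) ∧ ∀ x, 0 < F ε x := by
    intro ε hε
    have hpos : ∀ x, 0 < F ε x := fun x =>
      add_pos_of_nonneg_of_pos (mul_nonneg (by linarith [hε.2]) (hf.1 x)) hε.1
    refine ⟨⟨fun x => (hpos x).le, ?_⟩, hpos⟩
    have h1 : ∀ x, π x * F ε x = (1 - ε) * (π x * f x) + π x * ε := fun x => by
      simp only [F]
      ring
    rw [Finset.sum_congr rfl fun x _ => h1 x, Finset.sum_add_distrib, ← Finset.mul_sum,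
      ← Finset.sum_mul, hf.2, hP.sum_eq_one]
    ring
  have hmul : Continuous fun g : Ω → ℝ => (semigroup P t).mulVec g := by
    unfold Matrix.mulVec dotProduct
    fun_prop
  have hl : Tendsto (fun ε => Ent π ((semigroup P t).mulVec (F ε))) (nhdsWithin 0 (Set.Ioi 0))
      (nhds (Ent π ((semigroup P t).mulVec f))) := by
    have := ((continuous_ent π).comp (hmul.comp hF)).tendsto 0
    rw [Function.comp_apply, Function.comp_apply, hF0] at this
    exact this.mono_left nhdsWithin_le_nhds
  have hr : Tendsto (fun ε => Ent π (F ε) * Real.exp (-c * t)) (nhdsWithin 0 (Set.Ioi 0))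
      (nhds (Ent π f * Real.exp (-c * t))) := by
    have := ((continuous_ent π).comp hF).tendsto 0
    rw [Function.comp_apply, hF0] at this
    exact (this.mono_left nhdsWithin_le_nhds).mul_const _
  refine le_of_tendsto_of_tendsto hl hr ?_
  filter_upwards [Ioo_mem_nhdsGT (zero_lt_one (α := ℝ))] with ε hε
  exact ent_semigroup_le_of_pos hP hc (hdens ε hε).1 (hdens ε hε).2 ht

/-! ### Mixing -/

lemma semigroup_balance (hP : IsReversible P π) (t : ℝ) (x y : Ω) :
    π x * semigroup P t x y = π y * semigroup P t y x := by
  have hU : IsUnit (Matrix.diagonal π) := by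
    rw [Matrix.isUnit_diagonal, Pi.isUnit_iff]
    exact fun x => (hP.pos x).ne'.isUnit
  have h0 : Matrix.diagonal π * (t • (P - 1)) = (t • (P - 1)).transpose * Matrix.diagonal π := by
    ext x y
    rw [Matrix.diagonal_mul, Matrix.mul_diagonal]
    simp only [Matrix.smul_apply, Matrix.sub_apply, Matrix.transpose_apply, smul_eq_mul]
    rcases eq_or_ne x y with rfl | h
    · ring
    · rw [Matrix.one_apply_ne h, Matrix.one_apply_ne h.symm]
      linear_combination t * hP.balance x y
  have h1 : Matrix.diagonal π * (t • (P - 1)) * (Matrix.diagonal π)⁻¹ =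
      (t • (P - 1)).transpose := by
    rw [h0, Matrix.mul_nonsing_inv_cancel_right _ _ ((Matrix.isUnit_iff_isUnit_det _).1 hU)]
  have h2 := Matrix.exp_conj (Matrix.diagonal π) (t • (P - 1)) hU
  rw [h1, Matrix.exp_transpose] at h2
  have h3 : (semigroup P t).transpose * Matrix.diagonal π =
      Matrix.diagonal π * semigroup P t := by
    rw [semigroup, h2,
      Matrix.nonsing_inv_mul_cancel_right _ _ ((Matrix.isUnit_iff_isUnit_det _).1 hU)]
  have h4 := congrFun (congrFun h3 x) y
  rw [Matrix.diagonal_mul, Matrix.mul_diagonal, Matrix.transpose_apply] at h4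
  rw [← h4, mul_comm]

lemma sq_sub_one_le {u : ℝ} (hu : 0 ≤ u) :
    (u - 1) ^ 2 ≤ 2 * (u + 1) * (u * Real.log u - u + 1) := by
  obtain ⟨s, hs, rfl⟩ : ∃ s : ℝ, 0 ≤ s ∧ s ^ 2 = u := ⟨√u, Real.sqrt_nonneg u, Real.sq_sqrt hu⟩
  have h1 : (s - 1) ^ 2 ≤ s ^ 2 * Real.log (s ^ 2) - s ^ 2 + 1 := by
    rw [Real.log_pow]
    push_cast
    have := mul_le_mul_of_nonneg_left (sub_one_le_mul_log hs) hs
    nlinarith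
  calc (s ^ 2 - 1) ^ 2 = (s + 1) ^ 2 * (s - 1) ^ 2 := by ring
    _ ≤ 2 * (s ^ 2 + 1) * (s - 1) ^ 2 :=
      mul_le_mul_of_nonneg_right (by nlinarith [sq_nonneg (s - 1)]) (sq_nonneg _)
    _ ≤ _ := mul_le_mul_of_nonneg_left h1 (by positivity)

/-- A Pinsker type inequality, by comparison with the Hellinger distance. -/
lemma sq_sum_abs_sub_one_le (hP : IsReversible P π) {u : Ω → ℝ} (hu : IsDensity π u) :
    (∑ x, π x * |u x - 1|) ^ 2 ≤ 4 * Ent π u := by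
  have h1 : ∑ x, π x * (2 * (u x + 1)) = 4 := by
    have : ∀ x, π x * (2 * (u x + 1)) = 2 * (π x * u x) + 2 * π x := fun x => by ring
    rw [Finset.sum_congr rfl fun x _ => this x, Finset.sum_add_distrib, ← Finset.mul_sum,
      ← Finset.mul_sum, hu.2, hP.sum_eq_one]
    norm_num
  have h2 : ∑ x, π x * (u x * Real.log (u x) - u x + 1) = Ent π u := by
    rw [ent_of_isDensity hu]
    simp only [mul_add, mul_sub, mul_one, Finset.sum_add_distrib, Finset.sum_sub_distrib, hu.2,
      hP.sum_eq_one]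
    ring
  rw [← h1, ← h2]
  refine Finset.sum_sq_le_sum_mul_sum_of_sq_le_mul _ (fun x _ => ?_) (fun x _ => ?_) fun x _ => ?_
  · exact mul_nonneg (hP.pos x).le (by linarith [hu.1 x])
  · exact mul_nonneg (hP.pos x).le (by linarith [sub_one_le_mul_log (hu.1 x)])
  · rw [mul_pow, sq_abs]
    calc π x ^ 2 * (u x - 1) ^ 2 ≤ π x ^ 2 * _ :=
          mul_le_mul_of_nonneg_left (sq_sub_one_le (hu.1 x)) (sq_nonneg _)
      _ = _ := by ring

/-- Entropy decay from a point mass controls the total variation distance to equilibrium. -/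
lemma dTV_semigroup_sq_le (hP : IsReversible P π) {c : ℝ}
    (hc : ∀ f : Ω → ℝ, IsDensity π f → (∀ x, 0 < f x) → c * Ent π f ≤ realDirichlet P π f)
    {t : ℝ} (ht : 0 ≤ t) (y : Ω) :
    dTV (semigroup P t y) π ^ 2 ≤ -Real.log (π y) * Real.exp (-c * t) := by
  let f : Ω → ℝ := fun x => if x = y then (π y)⁻¹ else 0
  have hy := hP.pos y
  have hf : IsDensity π f := by
    refine ⟨fun x => ?_, ?_⟩
    · simp only [f]
      split_ifs
      · exact (inv_pos.2 hy).le
      · exact le_rfl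
    · simp [f, hy.ne']
  have hEnt : Ent π f = -Real.log (π y) := by
    rw [ent_of_isDensity hf, Finset.sum_eq_single y]
    · simp [f, hy.ne']
    · intro x _ hx
      simp [f, hx]
    · simp
  have hval : ∀ x, semigroup P t y x = π x * (semigroup P t).mulVec f x := by
    intro x
    have h1 : (semigroup P t).mulVec f x = semigroup P t x y * (π y)⁻¹ := by
      simp [Matrix.mulVec, dotProduct, f]
    rw [h1, ← mul_assoc, semigroup_balance hP t x y]
    field_simp
  have h1 : dTV (semigroup P t y) π = 1 / 2 * ∑ x, π x * |(semigroup P t).mulVec f x - 1| := by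
    rw [dTV]
    congr 1
    refine Finset.sum_congr rfl fun x _ => ?_
    rw [hval, ← mul_sub_one, abs_mul, abs_of_pos (hP.pos x)]
  have h2 := sq_sum_abs_sub_one_le hP (isDensity_semigroup hP hf ht)
  have h3 := ent_semigroup_le hP hc hf ht
  rw [hEnt] at h3
  rw [h1, mul_pow]
  linarith

lemma mixingTime_le (hP : IsReversible P π) {c : ℝ}
    (hc : ∀ f : Ω → ℝ, IsDensity π f → (∀ x, 0 < f x) → c * Ent π f ≤ realDirichlet P π f)
    {t : ℝ} (ht : 0 ≤ t) (h : ∀ y, -Real.log (π y) * Real.exp (-c * t) ≤ Real.exp (-2)) :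
    mixingTime P π ≤ ENNReal.ofReal t := by
  refine iInf₂_le_of_le t ⟨ht, fun y => ?_⟩ le_rfl
  refine le_of_sq_le_sq ?_ (Real.exp_nonneg _)
  rw [← Real.exp_nat_mul]
  refine (dTV_semigroup_sq_le hP hc ht y).trans ((h y).trans (le_of_eq ?_))
  norm_num

end Semigroup

/-! ### Entropy decay and mixing of the Glauber dynamics -/

section GlauberMixing

open scoped Classical

variable {I X : Type*} [Fintype I] [Fintype X] {μ : PMF (I → X)} {α₁ α₂ : ℝ}

lemma pow_le_cylMass (hα₁ : 0 < α₁) (h : α₁ ≤ betaTilde μ) {x : I → X} (hx : weight μ x ≠ 0)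
    (S : Finset I) : α₁ ^ S.card ≤ cylMass (weight μ) S x := by
  induction S using Finset.induction_on with
  | empty => simp [cylMass, sum_weight]
  | insert i S hi ih =>
    have h1 := le_cylMass_div h S i x hi hx
    rw [le_div_iff₀ (cylMass_pos (weight_nonneg μ) S hx)] at h1
    rw [Finset.card_insert_of_notMem hi, pow_succ']
    exact (mul_le_mul_of_nonneg_left ih hα₁.le).trans h1

/-- By the chain rule, all atoms of `μ` have mass at least `α₁ ^ |I|`. -/
lemma pow_le_mass (hα₁ : 0 < α₁) (h : α₁ ≤ betaTilde μ) (x : Supp μ) :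
    α₁ ^ Fintype.card I ≤ mass μ x := by
  have h1 := pow_le_cylMass hα₁ h (weight_ne_zero.2 x.2) Finset.univ
  have h2 : cylMass (weight μ) Finset.univ x.1 = mass μ x := by
    simp [cylMass, ← funext_iff, weight, mass]
  rwa [h2] at h1

lemma WeaklyDependent.isReversible [Nonempty I] (hμ : WeaklyDependent μ α₁ α₂) :
    IsReversible (glauber μ) (mass μ) := by
  obtain ⟨_, _, ⟨_, _, hQ, _⟩, _⟩ := hμ
  exact glauber_isReversible hQ

lemma mul_ent_le_realDirichlet [Nonempty I] (hα₁ : 0 < α₁) (hα₂ : 0 < α₂)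
    (hμ : WeaklyDependent μ α₁ α₂) (f : Supp μ → ℝ) (hf : IsDensity (mass μ) f)
    (hpos : ∀ x, 0 < f x) :
    α₁ * α₂ ^ 2 / (2 * (Fintype.card I : ℝ)) * Ent (mass μ) f ≤
      realDirichlet (glauber μ) (mass μ) f := by
  have h := ent_le_realDirichlet hα₁ hα₂ hμ hf.1 fun x y _ hy => absurd hy (hpos y).ne'
  have hE := ent_nonneg hμ.isReversible hf
  have hn : (0 : ℝ) < Fintype.card I := by positivity
  have h1 : α₁ * α₂ ^ 2 / (Fintype.card I : ℝ) * Ent (mass μ) f ≤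
      realDirichlet (glauber μ) (mass μ) f := by
    refine (mul_le_mul_of_nonneg_left h (by positivity)).trans (le_of_eq ?_)
    field_simp
  refine le_trans (mul_le_mul_of_nonneg_right ?_ hE) h1
  gcongr
  linarith

lemma mlsi_glauber [Nonempty I] (hα₁ : 0 < α₁) (hα₂ : 0 < α₂) (hμ : WeaklyDependent μ α₁ α₂) :
    MLSI (glauber μ) (mass μ) (2 * (Fintype.card I : ℝ) * α₁⁻¹ * (α₂ ^ 2)⁻¹) := by
  refine mlsi_of_realDirichlet mass_pos glauber_nonneg (by positivity) fun f hf hz => ?_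
  refine (ent_le_realDirichlet hα₁ hα₂ hμ hf hz).trans (le_of_eq ?_)
  ring

lemma mixingTime_glauber_le [Nonempty I] (hα₁ : 0 < α₁) (hα₂ : 0 < α₂)
    (hμ : WeaklyDependent μ α₁ α₂) (hn : Real.exp 1 ≤ Fintype.card I) :
    mixingTime (glauber μ) (mass μ) ≤
      ENNReal.ofReal (2 / (α₁ * α₂ ^ 2) * (3 + |Real.log α₁|) *
        ((Fintype.card I : ℝ) * Real.log (Fintype.card I : ℝ))) := by
  set n : ℝ := (Fintype.card I : ℝ) with hn_def
  have hn0 : 0 < n := (Real.exp_pos 1).trans_le hn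
  have hlog : 1 ≤ Real.log n := (Real.le_log_iff_exp_le hn0).2 hn
  set L := |Real.log α₁| with hL
  have hL0 : 0 ≤ L := abs_nonneg _
  -- The entropy of a point mass is at most `n * L ≤ exp (log n + L)`, so that this time is enough.
  have hmix := mixingTime_le hμ.isReversible (mul_ent_le_realDirichlet hα₁ hα₂ hμ)
    (t := 2 * n / (α₁ * α₂ ^ 2) * (2 + L + Real.log n)) (by positivity) (fun y => by
      have h1 : -Real.log (mass μ y) ≤ n * L := by
        have h2 := Real.log_le_log (by positivity) (pow_le_mass hα₁ hμ.1 y)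
        rw [Real.log_pow] at h2
        nlinarith [neg_abs_le (Real.log α₁)]
      have h3 : n * L ≤ Real.exp (Real.log n + L) := by
        rw [Real.exp_add, Real.exp_log hn0]
        exact mul_le_mul_of_nonneg_left (by linarith [Real.add_one_le_exp L]) hn0.le
      have h4 : -(α₁ * α₂ ^ 2 / (2 * n)) * (2 * n / (α₁ * α₂ ^ 2) * (2 + L + Real.log n)) =
          -2 - (Real.log n + L) := by
        field_simp
        ring
      rw [h4]
      calc _ ≤ Real.exp (Real.log n + L) * Real.exp (-2 - (Real.log n + L)) :=
            mul_le_mul_of_nonneg_right (h1.trans h3) (Real.exp_nonneg _)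
        _ = Real.exp (-2) := by
            rw [← Real.exp_add]
            ring_nf)
  refine hmix.trans (ENNReal.ofReal_le_ofReal ?_)
  have h5 : 2 + L + Real.log n ≤ (3 + L) * Real.log n := by nlinarith
  calc _ ≤ 2 * n / (α₁ * α₂ ^ 2) * ((3 + L) * Real.log n) :=
        mul_le_mul_of_nonneg_left h5 (by positivity)
    _ = _ := by ring

end GlauberMixing

end SpinSystem

end

theorem theorem2p2 {X : Type*} [Fintype X] (α₁ α₂ : ℝ) (hα₁ : 0 < α₁) (hα₂ : 0 < α₂) :
    (∀ (I : Type*) [Fintype I] [Nonempty I] (μ : PMF (I → X)),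
      SpinSystem.WeaklyDependent μ α₁ α₂ →
        SpinSystem.MLSI (SpinSystem.glauber μ) (SpinSystem.mass μ)
          (2 * (Fintype.card I : ℝ) * α₁⁻¹ * (α₂ ^ 2)⁻¹) ∧
        ∀ f : SpinSystem.Supp μ → ℝ, SpinSystem.IsDensity (SpinSystem.mass μ) f →
          ∀ t : ℝ, 0 ≤ t →
            SpinSystem.IsDensity (SpinSystem.mass μ)
              ((SpinSystem.semigroup (SpinSystem.glauber μ) t).mulVec f) ∧
            SpinSystem.Ent (SpinSystem.mass μ)
                ((SpinSystem.semigroup (SpinSystem.glauber μ) t).mulVec f) ≤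
              SpinSystem.Ent (SpinSystem.mass μ) f *
                Real.exp (-(α₁ * α₂ ^ 2 / (2 * (Fintype.card I : ℝ))) * t)) ∧
    (∀ (I : ℕ → Type*) [∀ n, Fintype (I n)] [∀ n, Nonempty (I n)]
      (μ : (n : ℕ) → PMF (I n → X)),
      Tendsto (fun n => Fintype.card (I n)) atTop atTop →
      (∀ n, SpinSystem.WeaklyDependent (μ n) α₁ α₂) →
        ∃ C : ℝ, 0 < C ∧ ∀ᶠ n in atTop,
          SpinSystem.mixingTime (SpinSystem.glauber (μ n)) (SpinSystem.mass (μ n)) ≤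
            ENNReal.ofReal
              (C * ((Fintype.card (I n) : ℝ) * Real.log (Fintype.card (I n) : ℝ)))) := by
  refine ⟨fun I _ _ μ hμ => ⟨SpinSystem.mlsi_glauber hα₁ hα₂ hμ, fun f hf t ht =>
    ⟨SpinSystem.isDensity_semigroup hμ.isReversible hf ht, ?_⟩⟩, fun I _ _ μ hI hμ => ?_⟩
  · exact SpinSystem.ent_semigroup_le hμ.isReversible
      (SpinSystem.mul_ent_le_realDirichlet hα₁ hα₂ hμ) hf ht
  · refine ⟨2 / (α₁ * α₂ ^ 2) * (3 + |Real.log α₁|), by positivity, ?_⟩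
    have hcard : Tendsto (fun n => (Fintype.card (I n) : ℝ)) atTop atTop :=
      tendsto_natCast_atTop_atTop.comp hI
    filter_upwards [hcard.eventually_ge_atTop (Real.exp 1)] with n hn
    exact SpinSystem.mixingTime_glauber_le hα₁ hα₂ (hμ n) hn
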